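/- Let $k$ be a natural number and let $Q$ be a generalized quantifier of type $\langle k\rangle$, i.e. a class of structures $(M,R)$ with $M$ a nonempty set and $R\subseteq M^k$; put $Q_M=\{R\subseteq M^k : (M,R)\in Q\}$. Assume that $Q$ is monotone increasing (for all $M$ and $A\subseteq B\subseteq M^k$, if $A\in Q_M$ then $B\in Q_M$) and that $\emptyset\notin Q_M$ for every $M$. The formulas of $\mathrm{D}(Q)$ are built from first-order atomic and negated atomic formulas and dependence atoms $D(t_1,\dots,t_{m},t_{m+1})$ ($m\ge 0$) and their negations by means of $\wedge$, $\vee$, $\exists y$, $\forall y$ and $Q\bar x$, where $\bar x$ is a $k$-tuple of distinct variables. They are evaluated on teams $X$ (sets of assignments into $M$ with a common finite domain of variables): a first-order literal holds in $X$ if every $s\in X$ satisfies it; $D(t_1,\dots,t_{m},t_{m+1})$ holds in $X$ if any $s,s'\in X$ that agree on the values of $t_1,\dots,t_m$ agree on the value of $t_{m+1}$; its negation holds only in $X=\emptyset$; $\varphi\wedge\psi$ holds in $X$ if both conjuncts do; $\varphi\vee\psi$ holds in $X$ if $X=Y\cup Z$ with $\varphi$ holding in $Y$ and $\psi$ in $Z$;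 $\exists y\,\varphi$ holds in $X$ if there is $f:X\to M$ such that $\varphi$ holds in $\{s[f(s)/y] : s\in X\}$; $\forall y\,\varphi$ holds in $X$ if $\varphi$ holds in $\{s[a/y] : s\in X, a\in M\}$; and $Q\bar x\,\varphi$ holds in $X$ if there is $F:X\to Q_M$ such that $\varphi$ holds in $\{s[\bar a/\bar x] : s\in X, \bar a\in F(s)\}$. A sentence is true in a structure if it holds in the team $\{\epsilon\}$ consisting of the empty assignment. The formulas of $\mathrm{ESO}(Q)$ are built from atomic and negated atomic formulas by means of $\wedge$, $\vee$, first-order $\exists$ and $\forall$, $Q\bar x$, and existential quantification over relations and functions of any finite arity, with the usual Tarskian semantics, where $s$ satisfies $Q\bar x\,\varphi$ iff $\{\bar a\in M^k : s[\bar a/\bar x]\text{ satisfies }\varphi\}\in Q_M$. Then, for sentences, $\mathrm{D}(Q)\equiv\mathrm{ESO}(Q)$: for every vocabulary $\tau$, every $\mathrm{D}(Q)[\tau]$-sentence has an $\mathrm{ESO}(Q)[\tau]$-sentence true in exactly the same $\tau$-structures (with nonempty universe), and every $\mathrm{ESO}(Q)[\tau]$-sentence has a $\mathrm{D}(Q)[\tau]$-sentence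 true in exactly the same $\tau$-structures. In particular this holds for every monotone increasing $Q$ with $(M,\emptyset)\notin Q$ and $(M,M^k)\in Q$ for all $M$. -/

import Mathlib

universe u v w

namespace TeamLogic

/-- A generalized quantifier of type `⟨k⟩`: a class of pairs `(M, R)` with `R ⊆ M^k`, given as
the family `M ↦ Q_M = {R ⊆ M^k | (M, R) ∈ Q}`. -/
def GenQuantifier (k : ℕ) : Type (w + 1) :=
  (M : Type w) → Set (Set (Fin k → M))

/-- `Q` is monotone increasing on every (nonempty) universe. -/
def GenQuantifier.MonotoneIncreasing {k : ℕ} (Q : GenQuantifier.{w} k) : Prop :=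
  ∀ (M : Type w) [Nonempty M] (A B : Set (Fin k → M)), A ⊆ B → A ∈ Q M → B ∈ Q M

/-- First-order atomic and negated atomic formulas with free variables among `x_0, …, x_{n-1}`. -/
inductive Literal (L : FirstOrder.Language.{u, v}) (n : ℕ) : Type (max u v)
  | eq (t₁ t₂ : L.Term (Fin n)) : Literal L n
  | ne (t₁ t₂ : L.Term (Fin n)) : Literal L n
  | rel {m : ℕ} (R : L.Relations m) (ts : Fin m → L.Term (Fin n)) : Literal L n
  | nrel {m : ℕ} (R : L.Relations m) (ts : Fin m → L.Term (Fin n)) : Literal L n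

/-- Tarskian satisfaction of a literal in a structure under an assignment. -/
def Literal.Realize {L : FirstOrder.Language.{u, v}} {n : ℕ} {M : Type w} [L.Structure M] :
    Literal L n → (Fin n → M) → Prop
  | .eq t₁ t₂, s => t₁.realize s = t₂.realize s
  | .ne t₁ t₂, s => t₁.realize s ≠ t₂.realize s
  | .rel R ts, s => FirstOrder.Language.Structure.RelMap R (fun i => (ts i).realize s)
  | .nrel R ts, s => ¬ FirstOrder.Language.Structure.RelMap R (fun i => (ts i).realize s)

/-! ### Dependence logic with a generalized quantifier -/

/-- Formulas of `D(Q)`, for `Q` of type `⟨k⟩`, in the vocabulary `L`, in negation normal form,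
with free variables among `x_0, …, x_{n-1}`. The quantifiers `∃`, `∀` bind the variable `x_n`;
the quantifier `Q` binds the `k` distinct variables `x_n, …, x_{n+k-1}`. -/
inductive DFormula (k : ℕ) (L : FirstOrder.Language.{u, v}) : ℕ → Type (max u v)
  | lit {n : ℕ} (l : Literal L n) : DFormula k L n
  | dep {n m : ℕ} (ts : Fin m → L.Term (Fin n)) (t : L.Term (Fin n)) : DFormula k L n
  | ndep {n m : ℕ} (ts : Fin m → L.Term (Fin n)) (t : L.Term (Fin n)) : DFormula k L n
  | and {n : ℕ} (φ ψ : DFormula k L n) : DFormula k L n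
  | or {n : ℕ} (φ ψ : DFormula k L n) : DFormula k L n
  | ex {n : ℕ} (φ : DFormula k L (n + 1)) : DFormula k L n
  | all {n : ℕ} (φ : DFormula k L (n + 1)) : DFormula k L n
  | quant {n : ℕ} (φ : DFormula k L (n + k)) : DFormula k L n

/-- A team of `M` with domain `{x_0, …, x_{n-1}}`: a set of assignments. -/
abbrev Team (M : Type w) (n : ℕ) : Type w := Set (Fin n → M)

/-- `X[f/x_n] = {s[f(s)/x_n] | s ∈ X}`. -/
def Team.supplement {M : Type w} {n : ℕ} (X : Team M n) (f : X → M) : Team M (n + 1) :=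
  {t | ∃ s : X, t = Fin.snoc s.1 (f s)}

/-- `X[M/x_n] = {s[a/x_n] | s ∈ X, a ∈ M}`. -/
def Team.duplicate {M : Type w} {n : ℕ} (X : Team M n) : Team M (n + 1) :=
  {t | ∃ s ∈ X, ∃ a : M, t = Fin.snoc s a}

/-- `X[F/x̄] = {s[ā/x̄] | s ∈ X, ā ∈ F(s)}`, where `x̄ = (x_n, …, x_{n+k-1})`. -/
def Team.supplementSet {M : Type w} {n k : ℕ} (X : Team M n) (F : X → Set (Fin k → M)) :
    Team M (n + k) :=
  {t | ∃ s : X, ∃ a ∈ F s, t = Fin.append s.1 a}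

/-- Team semantics of `D(Q)`. -/
def DFormula.Sat {k : ℕ} (Q : GenQuantifier.{w} k) {L : FirstOrder.Language.{u, v}} {M : Type w}
    [L.Structure M] : {n : ℕ} → DFormula k L n → Team M n → Prop
  | _, .lit l, X => ∀ s ∈ X, l.Realize s
  | _, .dep ts t, X => ∀ s ∈ X, ∀ s' ∈ X,
      (∀ i, (ts i).realize s = (ts i).realize s') → t.realize s = t.realize s'
  | _, .ndep _ _, X => X = ∅
  | _, .and φ ψ, X => φ.Sat Q X ∧ ψ.Sat Q X
  | _, .or φ ψ, X => ∃ Y Z : Team M _, X = Y ∪ Z ∧ φ.Sat Q Y ∧ ψ.Sat Q Z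
  | _, .ex φ, X => ∃ f : X → M, φ.Sat Q (X.supplement f)
  | _, .all φ, X => φ.Sat Q X.duplicate
  | _, .quant φ, X => ∃ F : X → Set (Fin k → M), (∀ s, F s ∈ Q M) ∧ φ.Sat Q (X.supplementSet F)

/-- Sentences of `D(Q)`. -/
abbrev DSentence (k : ℕ) (L : FirstOrder.Language.{u, v}) : Type (max u v) := DFormula k L 0

/-- A sentence is true in a structure if the team `{ε}` of the empty assignment satisfies it. -/
def DSentence.Holds {k : ℕ} (Q : GenQuantifier.{w} k) {L : FirstOrder.Language.{u, v}}
    (φ : DSentence k L) (M : Type w) [L.Structure M] : Prop :=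
  DFormula.Sat Q φ ({Fin.elim0} : Team M 0)

/-! ### Existential second-order logic with a generalized quantifier -/

/-- The family of symbols `S` with one new symbol of arity `m`. -/
inductive AddSymbol (S : ℕ → Type u) (m : ℕ) : ℕ → Type u
  | old {i : ℕ} (a : S i) : AddSymbol S m i
  | new : AddSymbol S m m

/-- The vocabulary `L ∪ {f}` with a new function symbol `f` of arity `m`. -/
def addFun (L : FirstOrder.Language.{u, v}) (m : ℕ) : FirstOrder.Language.{u, v} where
  Functions := AddSymbol L.Functions m
  Relations := L.Relations

/-- The vocabulary `L ∪ {R}` with a new relation symbol `R` of arity `m`. -/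
def addRel (L : FirstOrder.Language.{u, v}) (m : ℕ) : FirstOrder.Language.{u, v} where
  Functions := L.Functions
  Relations := AddSymbol L.Relations m

/-- The expansion `(M, f)` of an `L`-structure. -/
abbrev expandFun {L : FirstOrder.Language.{u, v}} {M : Type w} (S : L.Structure M) {m : ℕ}
    (f : (Fin m → M) → M) : (addFun L m).Structure M where
  funMap := fun {_} g => match g with
    | .old g => S.funMap g
    | .new => f
  RelMap := fun {_} R => S.RelMap R

/-- The expansion `(M, R)` of an `L`-structure. -/
abbrev expandRel {L : FirstOrder.Language.{u, v}} {M : Type w} (S : L.Structure M) {m : ℕ}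
    (R : (Fin m → M) → Prop) : (addRel L m).Structure M where
  funMap := fun {_} g => S.funMap g
  RelMap := fun {_} P => match P with
    | .old P => S.RelMap P
    | .new => R

/-- Formulas of `ESO(Q)`, for `Q` of type `⟨k⟩`, with first-order variables as in `DFormula`.
A second-order variable is a new symbol of the vocabulary within the scope of its quantifier. -/
inductive ESOFormula (k : ℕ) : FirstOrder.Language.{u, v} → ℕ → Type (max (u + 1) (v + 1))
  | lit {L : FirstOrder.Language.{u, v}} {n : ℕ} (l : Literal L n) : ESOFormula k L n
  | and {L : FirstOrder.Language.{u, v}} {n : ℕ} (φ ψ : ESOFormula k L n) : ESOFormula k L n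
  | or {L : FirstOrder.Language.{u, v}} {n : ℕ} (φ ψ : ESOFormula k L n) : ESOFormula k L n
  | ex {L : FirstOrder.Language.{u, v}} {n : ℕ} (φ : ESOFormula k L (n + 1)) : ESOFormula k L n
  | all {L : FirstOrder.Language.{u, v}} {n : ℕ} (φ : ESOFormula k L (n + 1)) : ESOFormula k L n
  | quant {L : FirstOrder.Language.{u, v}} {n : ℕ} (φ : ESOFormula k L (n + k)) : ESOFormula k L n
  | exFun {L : FirstOrder.Language.{u, v}} {n : ℕ} (m : ℕ) (φ : ESOFormula k (addFun L m) n) :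
      ESOFormula k L n
  | exRel {L : FirstOrder.Language.{u, v}} {n : ℕ} (m : ℕ) (φ : ESOFormula k (addRel L m) n) :
      ESOFormula k L n

/-- Tarskian semantics of `ESO(Q)`. -/
def ESOFormula.Sat {k : ℕ} (Q : GenQuantifier.{w} k) {M : Type w} :
    {L : FirstOrder.Language.{u, v}} → {n : ℕ} → ESOFormula k L n → L.Structure M → (Fin n → M) → Prop
  | _, _, .lit l, S, s => letI := S; l.Realize s
  | _, _, .and φ ψ, S, s => φ.Sat Q S s ∧ ψ.Sat Q S s
  | _, _, .or φ ψ, S, s => φ.Sat Q S s ∨ ψ.Sat Q S s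
  | _, _, .ex φ, S, s => ∃ a : M, φ.Sat Q S (Fin.snoc s a)
  | _, _, .all φ, S, s => ∀ a : M, φ.Sat Q S (Fin.snoc s a)
  | _, _, .quant φ, S, s => {a : Fin k → M | φ.Sat Q S (Fin.append s a)} ∈ Q M
  | _, _, .exFun m φ, S, s => ∃ f : (Fin m → M) → M, φ.Sat Q (expandFun S f) s
  | _, _, .exRel m φ, S, s => ∃ R : (Fin m → M) → Prop, φ.Sat Q (expandRel S R) s

/-- Sentences of `ESO(Q)`: no free first-order variables, and no symbols outside `L`. -/
abbrev ESOSentence (k : ℕ) (L : FirstOrder.Language.{u, v}) : Type (max (u + 1) (v + 1)) :=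
  ESOFormula k L 0

/-- Truth of an `ESO(Q)`-sentence in a structure. -/
def ESOSentence.Holds {k : ℕ} (Q : GenQuantifier.{w} k) {L : FirstOrder.Language.{u, v}}
    (φ : ESOSentence k L) (M : Type w) [S : L.Structure M] : Prop :=
  ESOFormula.Sat Q φ S Fin.elim0

end TeamLogic

/-! From D(Q) to ESO(Q): a team with domain x_0, …, x_{n-1} is an n-ary relation, and team semantics
speaks about such relations. Splitting a team, supplementing it by a function and choosing members
of Q_M become existential second-order quantifiers, while literals and dependence atoms become
universal first-order conditions. The clause for Q asks for a relation over the team whose section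
at each assignment of the team lies in Q_M (`DFormula.sat_toESO`).

From ESO(Q) to D(Q): second-order quantifiers are pulled out by Skolemization. A function quantified
in the scope of x_0, …, x_{n-1} becomes a global function with these variables as extra arguments.
This passes through Q because Q is monotone: witnesses belonging to different tuples act on
different arguments and can be amalgamated (`ESOFormula.sat_toFun`). With two elements available, a
relation is coded as the set where two functions agree.

What remains is put in prenex form, with function variables only in equations f(v) = y. A monotone
operator C on propositions is constant or the identity, so {a | C(a ∈ A)} ∈ Q_M iff C(A ∈ Q_M),
provided that ∅ ∉ Q_M and M^k ∈ Q_M; this moves Q to the front (`FunFormula.sat_prenex`). Evaluating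
the prefix in team semantics gathers all relevant assignments in one team, on which dependence atoms
express that a single valuation of the function variables solves all the equations
(`FunEqn.sat_system`, `PrenexFormula.sat_toD`).

Two cases escape this argument. On one-element universes second-order quantification ranges over
truth values. If M^k ∉ Q_M, then Q_M is empty by monotonicity, and subformulas beginning with Q are
false. The final sentence of D(Q) is a disjunction over these cases. -/

namespace TeamLogic

open FirstOrder FirstOrder.Language

/-! ### Literals and quantifier-free formulas -/

section Basics

variable {k : ℕ} {L L' : FirstOrder.Language.{u, v}} {M : Type w}

/-- Transport of a literal along a map of vocabularies and a substitution of variables. -/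
def Literal.map {n m : ℕ} (i : L →ᴸ L') (ρ : Fin n → Fin m) : Literal L n → Literal L' m
  | .eq t₁ t₂ => .eq (i.onTerm (t₁.relabel ρ)) (i.onTerm (t₂.relabel ρ))
  | .ne t₁ t₂ => .ne (i.onTerm (t₁.relabel ρ)) (i.onTerm (t₂.relabel ρ))
  | .rel R ts => .rel (i.onRelation R) fun j => i.onTerm ((ts j).relabel ρ)
  | .nrel R ts => .nrel (i.onRelation R) fun j => i.onTerm ((ts j).relabel ρ)

theorem Literal.realize_map [L.Structure M] [L'.Structure M] {n m : ℕ} (i : L →ᴸ L')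
    [i.IsExpansionOn M] (ρ : Fin n → Fin m) (l : Literal L n) (s : Fin m → M) :
    (l.map i ρ).Realize s ↔ l.Realize (s ∘ ρ) := by
  cases l <;> simp [Literal.map, Literal.Realize, LHom.map_onRelation]

/-- Quantifier-free formulas. -/
inductive QFFormula (L : FirstOrder.Language.{u, v}) (n : ℕ) : Type (max u v)
  | lit (l : Literal L n) : QFFormula L n
  | and (φ ψ : QFFormula L n) : QFFormula L n
  | or (φ ψ : QFFormula L n) : QFFormula L n

namespace QFFormula

def Realize {n : ℕ} [L.Structure M] : QFFormula L n → (Fin n → M) → Prop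
  | .lit l, s => l.Realize s
  | .and φ ψ, s => φ.Realize s ∧ ψ.Realize s
  | .or φ ψ, s => φ.Realize s ∨ ψ.Realize s

/-- Substitution of variables in a quantifier-free formula. -/
def rename {n m : ℕ} (ρ : Fin n → Fin m) : QFFormula L n → QFFormula L m
  | .lit l => .lit (l.map (LHom.id L) ρ)
  | .and φ ψ => .and (φ.rename ρ) (ψ.rename ρ)
  | .or φ ψ => .or (φ.rename ρ) (ψ.rename ρ)

theorem realize_rename {S : L.Structure M} {n m : ℕ} (ρ : Fin n → Fin m) (φ : QFFormula L n)
    (s : Fin m → M) : (φ.rename ρ).Realize s ↔ φ.Realize (s ∘ ρ) := by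
  induction φ with
  | lit l => exact Literal.realize_map _ _ _ _
  | and φ ψ ih₁ ih₂ => simp [rename, Realize, ih₁, ih₂]
  | or φ ψ ih₁ ih₂ => simp [rename, Realize, ih₁, ih₂]

/-- The disjunction of `φ` with the formulas of a list. -/
def ors {n : ℕ} (φ : QFFormula L n) : List (QFFormula L n) → QFFormula L n
  | [] => φ
  | ψ :: l => .or ψ (ors φ l)

theorem realize_ors {S : L.Structure M} {n : ℕ} (φ : QFFormula L n) (l : List (QFFormula L n))
    (s : Fin n → M) : (ors φ l).Realize s ↔ (∃ ψ ∈ l, ψ.Realize s) ∨ φ.Realize s := by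
  induction l with
  | nil => simp [ors]
  | cons ψ l ih => simp [ors, Realize, ih, or_assoc]

/-- The atom `R(x_{ρ 0}, …, x_{ρ (m-1)})`. -/
def atom {n m : ℕ} (R : L.Relations m) (ρ : Fin m → Fin n) : QFFormula L n :=
  .lit (.rel R fun i => .var (ρ i))

/-- The negated atom `¬R(x_{ρ 0}, …, x_{ρ (m-1)})`. -/
def natom {n m : ℕ} (R : L.Relations m) (ρ : Fin m → Fin n) : QFFormula L n :=
  .lit (.nrel R fun i => .var (ρ i))

theorem realize_atom {S : L.Structure M} {n m : ℕ} (R : L.Relations m) (ρ : Fin m → Fin n)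
    (s : Fin n → M) : (atom R ρ).Realize s ↔ S.RelMap R (s ∘ ρ) := Iff.rfl

theorem realize_natom {S : L.Structure M} {n m : ℕ} (R : L.Relations m) (ρ : Fin m → Fin n)
    (s : Fin n → M) : (natom R ρ).Realize s ↔ ¬ S.RelMap R (s ∘ ρ) := Iff.rfl

/-- A quantifier-free formula as a formula of `ESO(Q)`. -/
def toESO {n : ℕ} : QFFormula L n → ESOFormula k L n
  | .lit l => .lit l
  | .and φ ψ => .and φ.toESO ψ.toESO
  | .or φ ψ => .or φ.toESO ψ.toESO

theorem sat_toESO (Q : GenQuantifier.{w} k) {S : L.Structure M} {n : ℕ} (φ : QFFormula L n)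
    (s : Fin n → M) : (φ.toESO (k := k)).Sat Q S s ↔ φ.Realize s := by
  induction φ with
  | lit l => rfl
  | and φ ψ ih₁ ih₂ => simp [toESO, Realize, ESOFormula.Sat, ih₁, ih₂]
  | or φ ψ ih₁ ih₂ => simp [toESO, Realize, ESOFormula.Sat, ih₁, ih₂]

/-- A quantifier-free formula as a formula of `D(Q)`. -/
def toD {n : ℕ} : QFFormula L n → DFormula k L n
  | .lit l => .lit l
  | .and φ ψ => .and φ.toD ψ.toD
  | .or φ ψ => .or φ.toD ψ.toD

/-- Quantifier-free formulas are flat. -/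
theorem sat_toD (Q : GenQuantifier.{w} k) [L.Structure M] {n : ℕ} (φ : QFFormula L n)
    (X : Team M n) : (φ.toD (k := k)).Sat Q X ↔ ∀ s ∈ X, φ.Realize s := by
  induction φ generalizing X with
  | lit l => rfl
  | and φ ψ ih₁ ih₂ =>
    simp only [toD, Realize, DFormula.Sat, ih₁, ih₂]
    exact ⟨fun h s hs => ⟨h.1 s hs, h.2 s hs⟩, fun h => ⟨fun s hs => (h s hs).1,
      fun s hs => (h s hs).2⟩⟩
  | or φ ψ ih₁ ih₂ =>
    simp only [toD, Realize, DFormula.Sat, ih₁, ih₂]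
    constructor
    · rintro ⟨Y, Z, rfl, hY, hZ⟩ s (hs | hs)
      exacts [Or.inl (hY s hs), Or.inr (hZ s hs)]
    · intro h
      refine ⟨{s ∈ X | φ.Realize s}, {s ∈ X | ψ.Realize s}, ?_, fun s hs => hs.2, fun s hs => hs.2⟩
      ext s
      constructor
      · intro hs
        exact (h s hs).imp (fun h => ⟨hs, h⟩) (fun h => ⟨hs, h⟩)
      · rintro (hs | hs) <;> exact hs.1

end QFFormula

end Basics

/-! ### From D(Q) to ESO(Q): teams as relations -/

section DToESO

variable {k : ℕ} {L L' : FirstOrder.Language.{u, v}} {M : Type w}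

/-- Universal closure of a formula of `ESO(Q)`. -/
def ESOFormula.closure : (n : ℕ) → ESOFormula k L n → ESOFormula k L 0
  | 0, φ => φ
  | n + 1, φ => ESOFormula.closure n (.all φ)

theorem ESOFormula.sat_closure (Q : GenQuantifier.{w} k) (S : L.Structure M) {n : ℕ}
    (φ : ESOFormula k L n) :
    (φ.closure n).Sat Q S Fin.elim0 ↔ ∀ s : Fin n → M, φ.Sat Q S s := by
  induction n with
  | zero =>
    refine ⟨fun h s => ?_, fun h => h _⟩
    rw [Subsingleton.elim s Fin.elim0]
    exact h
  | succ n ih =>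
    rw [ESOFormula.closure, ih]
    refine ⟨fun h s => ?_, fun h s a => h _⟩
    rw [← Fin.snoc_init_self s]
    exact h _ _

/-- The inclusion of a vocabulary in its extension by a relation symbol. -/
def inclRel (L : FirstOrder.Language.{u, v}) (m : ℕ) : L →ᴸ addRel L m where
  onFunction _ f := f
  onRelation _ R := .old R

/-- The inclusion of a vocabulary in its extension by a function symbol. -/
def inclFun (L : FirstOrder.Language.{u, v}) (m : ℕ) : L →ᴸ addFun L m where
  onFunction _ f := .old f
  onRelation _ R := R

def newRel (L : FirstOrder.Language.{u, v}) (m : ℕ) : (addRel L m).Relations m := .new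

def newFun (L : FirstOrder.Language.{u, v}) (m : ℕ) : (addFun L m).Functions m := .new

/-- `S'` expands `S` along `i`. -/
def Expands (i : L →ᴸ L') (S : L.Structure M) (S' : L'.Structure M) : Prop :=
  @LHom.IsExpansionOn L L' i M S S'

theorem Expands.rel {i : L →ᴸ L'} {S : L.Structure M} {S' : L'.Structure M}
    (h : Expands i S S') {m : ℕ} (R : (Fin m → M) → Prop) :
    Expands ((inclRel L' m).comp i) S (expandRel S' R) :=
  @LHom.IsExpansionOn.mk _ _ _ _ S (expandRel S' R) (fun f x => h.map_onFunction f x)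
    (fun R x => h.map_onRelation R x)

theorem Expands.func {i : L →ᴸ L'} {S : L.Structure M} {S' : L'.Structure M}
    (h : Expands i S S') {m : ℕ} (f : (Fin m → M) → M) :
    Expands ((inclFun L' m).comp i) S (expandFun S' f) :=
  @LHom.IsExpansionOn.mk _ _ _ _ S (expandFun S' f) (fun f x => h.map_onFunction f x)
    (fun R x => h.map_onRelation R x)

open QFFormula in
/-- The sentence of `ESO(Q)` that says that the team `{s | R s}` satisfies a formula of `D(Q)`. -/
def DFormula.toESO : {n : ℕ} → DFormula k L n → {L' : FirstOrder.Language.{u, v}} → (L →ᴸ L') →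
    L'.Relations n → ESOFormula k L' 0
  | n, .lit l, _, i, R =>
    ESOFormula.closure n (QFFormula.or (natom R id) (.lit (l.map i id))).toESO
  | n, .dep ts t, _, i, R =>
    ESOFormula.closure (n + n) (ors
      (.or (natom R (Fin.castAdd n)) (.or (natom R (Fin.natAdd n))
        (.lit (.eq (i.onTerm (t.relabel (Fin.castAdd n)))
          (i.onTerm (t.relabel (Fin.natAdd n)))))))
      (List.ofFn fun j => .lit (.ne (i.onTerm ((ts j).relabel (Fin.castAdd n)))
          (i.onTerm ((ts j).relabel (Fin.natAdd n)))))).toESO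
  | n, .ndep _ _, _, _, R => ESOFormula.closure n (natom R id).toESO
  | _, .and φ ψ, _, i, R => .and (φ.toESO i R) (ψ.toESO i R)
  | n, .or φ ψ, L', i, R =>
    let i' := inclRel (addRel L' n) n
    let R' := i'.onRelation ((inclRel L' n).onRelation R)
    let Y := i'.onRelation (newRel L' n)
    let Z := newRel (addRel L' n) n
    .exRel n (.exRel n (.and
      (ESOFormula.closure n (QFFormula.and
        (.or (natom R' id) (.or (atom Y id) (atom Z id)))
        (.and (.or (natom Y id) (atom R' id)) (.or (natom Z id) (atom R' id)))).toESO)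
      (.and (φ.toESO (i'.comp ((inclRel L' n).comp i)) Y)
        (ψ.toESO (i'.comp ((inclRel L' n).comp i)) Z))))
  | n, .ex φ, L', i, R =>
    let i' := inclRel (addFun L' n) (n + 1)
    let R' := i'.onRelation ((inclFun L' n).onRelation R)
    let f := i'.onFunction (newFun L' n)
    let T := newRel (addFun L' n) (n + 1)
    let t := Term.func f fun j : Fin n => .var j.castSucc
    .exFun n (.exRel (n + 1) (.and
      (ESOFormula.closure (n + 1) (QFFormula.and
        (.or (natom T id) (.and (atom R' Fin.castSucc)
          (.lit (.eq (.var (Fin.last n)) t))))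
        (.or (atom T id) (.or (natom R' Fin.castSucc)
          (.lit (.ne (.var (Fin.last n)) t))))).toESO)
      (φ.toESO (i'.comp ((inclFun L' n).comp i)) T)))
  | n, .all φ, L', i, R =>
    let i' := inclRel L' (n + 1)
    let T := newRel L' (n + 1)
    .exRel (n + 1) (.and
      (ESOFormula.closure (n + 1) (QFFormula.and
        (.or (natom T id) (atom (i'.onRelation R) Fin.castSucc))
        (.or (atom T id) (natom (i'.onRelation R) Fin.castSucc))).toESO)
      (φ.toESO (i'.comp i) T))
  | n, .quant φ, L', i, R =>
    let i' := inclRel L' (n + k)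
    let T := newRel L' (n + k)
    .exRel (n + k) (.and
      (.and
        (ESOFormula.closure (n + k)
          (QFFormula.or (natom T id) (atom (i'.onRelation R) (Fin.castAdd k))).toESO)
        (ESOFormula.closure n
          (.or (natom (i'.onRelation R) id).toESO (.quant (atom T id).toESO))))
      (φ.toESO (i'.comp i) T))

theorem Fin.append_comp_castAdd {α : Type*} {m n : ℕ} (s : Fin m → α) (a : Fin n → α) :
    Fin.append s a ∘ Fin.castAdd n = s := by
  funext i
  simp

theorem Fin.append_comp_natAdd {α : Type*} {m n : ℕ} (s : Fin m → α) (a : Fin n → α) :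
    Fin.append s a ∘ Fin.natAdd m = a := by
  funext i
  simp

theorem Fin.snoc_comp_castSucc' {α : Type*} {n : ℕ} (s : Fin n → α) (a : α) :
    (Fin.snoc s a : Fin (n + 1) → α) ∘ Fin.castSucc = s := by
  funext i
  simp

theorem forall_append {α : Type*} {m n : ℕ} {p : (Fin (m + n) → α) → Prop} :
    (∀ s, p s) ↔ ∀ (s : Fin m → α) (a : Fin n → α), p (Fin.append s a) := by
  refine ⟨fun h s a => h _, fun h s => ?_⟩
  rw [← Fin.append_castAdd_natAdd (f := s)]
  exact h _ _

theorem forall_snoc {α : Type*} {n : ℕ} {p : (Fin (n + 1) → α) → Prop} :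
    (∀ s, p s) ↔ ∀ (s : Fin n → α) (a : α), p (Fin.snoc s a) := by
  refine ⟨fun h s a => h _, fun h s => ?_⟩
  rw [← Fin.snoc_init_self s]
  exact h _ _

theorem Team.mem_supplement {n : ℕ} (X : Team M n) (f : X → M) (s : Fin n → M) (a : M) :
    (Fin.snoc s a : Fin (n + 1) → M) ∈ X.supplement f ↔ ∃ h : s ∈ X, a = f ⟨s, h⟩ := by
  constructor
  · rintro ⟨⟨s', h⟩, hs⟩
    obtain ⟨rfl, rfl⟩ := Fin.snoc_injective2 hs
    exact ⟨h, rfl⟩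
  · rintro ⟨h, rfl⟩
    exact ⟨⟨s, h⟩, rfl⟩

theorem Team.mem_duplicate {n : ℕ} (X : Team M n) (s : Fin n → M) (a : M) :
    (Fin.snoc s a : Fin (n + 1) → M) ∈ X.duplicate ↔ s ∈ X := by
  constructor
  · rintro ⟨s', h, a', hs⟩
    obtain ⟨rfl, rfl⟩ := Fin.snoc_injective2 hs
    exact h
  · exact fun h => ⟨s, h, a, rfl⟩

theorem Fin.append_inj {α : Type*} {m n : ℕ} {s s' : Fin m → α} {a a' : Fin n → α}
    (h : Fin.append s a = Fin.append s' a') : s = s' ∧ a = a' := by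
  constructor
  · rw [← Fin.append_comp_castAdd s a, h, Fin.append_comp_castAdd]
  · rw [← Fin.append_comp_natAdd s a, h, Fin.append_comp_natAdd]

theorem Team.mem_supplementSet {n : ℕ} (X : Team M n) (F : X → Set (Fin k → M)) (s : Fin n → M)
    (a : Fin k → M) : Fin.append s a ∈ X.supplementSet F ↔ ∃ h : s ∈ X, a ∈ F ⟨s, h⟩ := by
  constructor
  · rintro ⟨⟨s', h⟩, a', ha, hs⟩
    obtain ⟨rfl, rfl⟩ := Fin.append_inj hs
    exact ⟨h, ha⟩
  · rintro ⟨h, ha⟩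
    exact ⟨⟨s, h⟩, a, ha, rfl⟩

/-- The vocabulary `L'` and the symbol `R` are arbitrary because each connective that changes the
team introduces a new symbol for the new team; the induction continues in the larger vocabulary. -/
theorem DFormula.sat_toESO (Q : GenQuantifier.{w} k) [Nonempty M] [S : L.Structure M] {n : ℕ}
    (φ : DFormula k L n) {L' : FirstOrder.Language.{u, v}} (i : L →ᴸ L') (S' : L'.Structure M)
    (hi : Expands i S S') (R : L'.Relations n) :
    (φ.toESO i R).Sat Q S' Fin.elim0 ↔ φ.Sat Q {s | S'.RelMap R s} := by
  induction φ generalizing L' with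
  | lit l =>
    simp only [DFormula.toESO, DFormula.Sat, ESOFormula.sat_closure, QFFormula.sat_toESO,
      QFFormula.Realize, QFFormula.realize_natom, @Literal.realize_map L L' M S S' _ _ i hi,
      Function.comp_id, Set.mem_ofPred_eq, imp_iff_not_or]
  | @dep n m ts t =>
    have h (t : L.Term (Fin n)) (ρ : Fin n → Fin (n + n)) (s : Fin (n + n) → M) :
        @Term.realize L' M S' _ s (i.onTerm (t.relabel ρ)) = t.realize (s ∘ ρ) := by
      rw [@LHom.realize_onTerm L L' M S _ S' i hi, Term.realize_relabel]
    simp only [DFormula.toESO, DFormula.Sat, ESOFormula.sat_closure, QFFormula.sat_toESO,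
      QFFormula.realize_ors, QFFormula.Realize, QFFormula.realize_natom, forall_append,
      Fin.append_comp_castAdd, Fin.append_comp_natAdd, Set.mem_ofPred_eq, List.mem_ofFn,
      exists_exists_eq_and, Literal.Realize, h]
    refine forall_congr' fun s => ?_
    refine ⟨fun h hs s' hs' hts => ?_, fun h s' => ?_⟩
    · have := h s'
      simp only [hs, hs', not_true_eq_false, false_or, ← not_forall] at this
      exact this.resolve_left (not_not.2 hts)
    · rw [← not_forall]
      have := h (s' := s')
      tauto
  | ndep ts t =>
    simp only [DFormula.toESO, DFormula.Sat, ESOFormula.sat_closure, QFFormula.sat_toESO,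
      QFFormula.realize_natom, Function.comp_id, Set.eq_empty_iff_forall_notMem,
      Set.mem_ofPred_eq]
  | and φ ψ ih₁ ih₂ =>
    simp only [DFormula.toESO, DFormula.Sat, ESOFormula.Sat, ih₁ i S' hi R, ih₂ i S' hi R]
  | @or n φ ψ ih₁ ih₂ =>
    simp only [DFormula.toESO, DFormula.Sat, ESOFormula.Sat]
    have key (Y Z : (Fin n → M) → Prop) := ih₁ _ _ ((hi.rel Y).rel Z)
    have key' (Y Z : (Fin n → M) → Prop) := ih₂ _ _ ((hi.rel Y).rel Z)
    simp only [key, key', ESOFormula.sat_closure, QFFormula.sat_toESO, QFFormula.Realize,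
      QFFormula.realize_natom, QFFormula.realize_atom, Function.comp_id]
    constructor
    · rintro ⟨Y, Z, h, hY, hZ⟩
      refine ⟨{s | Y s}, {s | Z s}, ?_, hY, hZ⟩
      ext s
      have := h s
      change (¬ S'.RelMap R s ∨ Y s ∨ Z s) ∧ (¬ Y s ∨ S'.RelMap R s) ∧
        (¬ Z s ∨ S'.RelMap R s) at this
      change S'.RelMap R s ↔ Y s ∨ Z s
      tauto
    · rintro ⟨Y, Z, h, hY, hZ⟩
      refine ⟨(· ∈ Y), (· ∈ Z), fun s => ?_, hY, hZ⟩
      have : S'.RelMap R s ↔ s ∈ Y ∨ s ∈ Z := Set.ext_iff.1 h s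
      change (¬ S'.RelMap R s ∨ s ∈ Y ∨ s ∈ Z) ∧ (¬ s ∈ Y ∨ S'.RelMap R s) ∧
        (¬ s ∈ Z ∨ S'.RelMap R s)
      tauto
  | @ex n φ ih =>
    simp only [DFormula.toESO, DFormula.Sat, ESOFormula.Sat]
    have key (f : (Fin n → M) → M) (T : (Fin (n + 1) → M) → Prop) := ih _ _ ((hi.func f).rel T)
    simp only [key, ESOFormula.sat_closure, QFFormula.sat_toESO, QFFormula.Realize,
      QFFormula.realize_natom, QFFormula.realize_atom, Function.comp_id, Literal.Realize,
      Term.realize]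
    have spec (f : (Fin n → M) → M) (T : (Fin (n + 1) → M) → Prop) :
        {t | T t} = Team.supplement {s | S'.RelMap R s} (fun s => f s.1) ↔
        ∀ t : Fin (n + 1) → M, (¬ T t ∨ S'.RelMap R (t ∘ Fin.castSucc) ∧
          t (Fin.last n) = f (t ∘ Fin.castSucc)) ∧
          (T t ∨ ¬ S'.RelMap R (t ∘ Fin.castSucc) ∨ t (Fin.last n) ≠ f (t ∘ Fin.castSucc)) := by
      rw [Set.ext_iff, forall_snoc, forall_snoc]
      refine forall_congr' fun s => forall_congr' fun a => ?_
      rw [Team.mem_supplement]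
      simp only [Fin.snoc_comp_castSucc', Fin.snoc_last, Set.mem_ofPred_eq, exists_prop]
      tauto
    constructor
    · rintro ⟨f, T, h, hT⟩
      refine ⟨fun s => f s.1, ?_⟩
      rw [← (spec f T).2 h]
      exact hT
    · rintro ⟨f, hf⟩
      classical
      -- A choice function on the team is partial, whereas a quantified function symbol is total;
      -- its values outside the team do not matter.
      let g : (Fin n → M) → M := fun s =>
        if h : S'.RelMap R s then f ⟨s, h⟩ else Classical.arbitrary M
      have hg : f = fun s => g s.1 := funext fun s => by
        simp only [g, dif_pos (show S'.RelMap R s.1 from s.2)]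
      rw [hg] at hf
      exact ⟨g, (· ∈ Team.supplement {s | S'.RelMap R s} fun s => g s.1), (spec g _).1 rfl, hf⟩
  | @all n φ ih =>
    simp only [DFormula.toESO, DFormula.Sat, ESOFormula.Sat]
    have key (T : (Fin (n + 1) → M) → Prop) := ih _ _ (hi.rel T)
    simp only [key, ESOFormula.sat_closure, QFFormula.sat_toESO, QFFormula.Realize,
      QFFormula.realize_natom, QFFormula.realize_atom, Function.comp_id]
    have spec (T : (Fin (n + 1) → M) → Prop) :
        {t | T t} = Team.duplicate {s | S'.RelMap R s} ↔
        ∀ t : Fin (n + 1) → M, (¬ T t ∨ S'.RelMap R (t ∘ Fin.castSucc)) ∧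
          (T t ∨ ¬ S'.RelMap R (t ∘ Fin.castSucc)) := by
      rw [Set.ext_iff, forall_snoc, forall_snoc]
      refine forall_congr' fun s => forall_congr' fun a => ?_
      rw [Team.mem_duplicate]
      simp only [Fin.snoc_comp_castSucc', Set.mem_ofPred_eq]
      tauto
    constructor
    · rintro ⟨T, h, hT⟩
      rw [← (spec T).2 h]
      exact hT
    · intro h
      exact ⟨(· ∈ Team.duplicate {s | S'.RelMap R s}), (spec _).1 rfl, h⟩
  | @quant n φ ih =>
    simp only [DFormula.toESO, DFormula.Sat, ESOFormula.Sat]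
    have key (T : (Fin (n + k) → M) → Prop) := ih _ _ (hi.rel T)
    simp only [key, ESOFormula.sat_closure, QFFormula.sat_toESO, QFFormula.Realize,
      QFFormula.realize_natom, QFFormula.realize_atom, Function.comp_id, ESOFormula.Sat]
    constructor
    · rintro ⟨T, ⟨h₁, h₂⟩, hT⟩
      have h₁ (t : Fin (n + k) → M) : ¬ T t ∨ S'.RelMap R (t ∘ Fin.castAdd k) := h₁ t
      have h₂ (s : Fin n → M) : ¬ S'.RelMap R s ∨ {a | T (Fin.append s a)} ∈ Q M := h₂ s
      -- The set chosen at s is the section of T at s.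
      refine ⟨fun s => {a | T (Fin.append s.1 a)}, fun s => (h₂ s).resolve_left (not_not.2 s.2), ?_⟩
      convert hT
      ext t
      revert t
      rw [forall_append]
      intro s a
      rw [Team.mem_supplementSet]
      have := h₁ (Fin.append s a)
      rw [Fin.append_comp_castAdd] at this
      change (∃ h : S'.RelMap R s, T (Fin.append s a)) ↔ T (Fin.append s a)
      rw [exists_prop]
      tauto
    · rintro ⟨F, hF, h⟩
      refine ⟨(· ∈ Team.supplementSet {s | S'.RelMap R s} F), ⟨?_, fun s => ?_⟩, h⟩
      · rw [forall_append]
        intro s a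
        rw [Fin.append_comp_castAdd]
        change ¬ Fin.append s a ∈ Team.supplementSet {s | S'.RelMap R s} F ∨ S'.RelMap R s
        rw [Team.mem_supplementSet]
        by_cases hs : S'.RelMap R s
        · exact Or.inr hs
        · exact Or.inl fun h => hs h.1
      · change ¬ S'.RelMap R s ∨
          {a | Fin.append s a ∈ Team.supplementSet {s | S'.RelMap R s} F} ∈ Q M
        by_cases hs : S'.RelMap R s
        · right
          convert hF ⟨s, hs⟩
          ext a
          rw [Set.mem_ofPred_eq, Team.mem_supplementSet]
          exact ⟨fun h => h.2, fun h => ⟨hs, h⟩⟩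
        · exact Or.inl hs

/-- The team {ε} is the full relation of arity 0, so the translation is started from a quantified
0-ary relation symbol that is required to be true. -/
theorem exists_ESO_of_D (Q : GenQuantifier.{w} k) (φ : DSentence k L) :
    ∃ ψ : ESOSentence k L, ∀ (M : Type w) [Nonempty M] [L.Structure M],
      φ.Holds Q M ↔ ψ.Holds Q M := by
  refine ⟨.exRel 0 (.and (QFFormula.atom (newRel L 0) id).toESO
    (φ.toESO (inclRel L 0) (newRel L 0))), fun M _ S => ?_⟩
  simp only [ESOSentence.Holds, DSentence.Holds, ESOFormula.Sat]
  have hi (R : (Fin 0 → M) → Prop) : Expands (inclRel L 0) S (expandRel S R) :=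
    Expands.rel (i := LHom.id L) (LHom.id_isExpansionOn M) R
  have key (R : (Fin 0 → M) → Prop) := DFormula.sat_toESO Q φ _ _ (hi R)
  simp only [key, QFFormula.sat_toESO, QFFormula.realize_atom, Function.comp_id]
  have huniv (X : Set (Fin 0 → M)) (h : Fin.elim0 ∈ X) : X = {Fin.elim0} := by
    ext s
    rw [Subsingleton.elim s Fin.elim0]
    simp [h]
  constructor
  · intro h
    refine ⟨fun _ => True, trivial, ?_⟩
    have := huniv {s | (fun _ : Fin 0 → M => True) s} trivial
    rw [← this] at h
    exact h
  · rintro ⟨R, hR, h⟩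
    have := huniv {s | R s} hR
    rw [← this]
    exact h

end DToESO

/-! ### Prenex forms with function variables -/

section Prenex

variable {k : ℕ} {L : FirstOrder.Language.{u, v}} {M : Type w}

/-- A valuation of the function variables: the value of the variable `i` is a function of tuples of
any length. -/
abbrev FunVal (M : Type w) : Type w := ℕ → List M → M

/-- First-order formulas with the quantifier `Q` and function variables. -/
inductive FunFormula (k : ℕ) (L : FirstOrder.Language.{u, v}) : ℕ → Type (max u v)
  | lit {n : ℕ} (l : Literal L n) : FunFormula k L n
  | eqn {n : ℕ} (i : ℕ) (v : List (Fin n)) (y : Fin n) : FunFormula k L n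
  | and {n : ℕ} (φ ψ : FunFormula k L n) : FunFormula k L n
  | or {n : ℕ} (φ ψ : FunFormula k L n) : FunFormula k L n
  | ex {n : ℕ} (φ : FunFormula k L (n + 1)) : FunFormula k L n
  | all {n : ℕ} (φ : FunFormula k L (n + 1)) : FunFormula k L n
  | quant {n : ℕ} (φ : FunFormula k L (n + k)) : FunFormula k L n

def FunFormula.Sat (Q : GenQuantifier.{w} k) [L.Structure M] (F : FunVal M) :
    {n : ℕ} → FunFormula k L n → (Fin n → M) → Prop
  | _, .lit l, s => l.Realize s
  | _, .eqn i v y, s => F i (v.map s) = s y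
  | _, .and φ ψ, s => φ.Sat Q F s ∧ ψ.Sat Q F s
  | _, .or φ ψ, s => φ.Sat Q F s ∨ ψ.Sat Q F s
  | _, .ex φ, s => ∃ a : M, φ.Sat Q F (Fin.snoc s a)
  | _, .all φ, s => ∀ a : M, φ.Sat Q F (Fin.snoc s a)
  | _, .quant φ, s => {a : Fin k → M | φ.Sat Q F (Fin.append s a)} ∈ Q M

/-- Prenex formulas with function variables; `app i v φ` is `φ` with `x_n` the value of the function
variable `i` at `v`. -/
inductive PrenexFormula (k : ℕ) (L : FirstOrder.Language.{u, v}) : ℕ → Type (max u v)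
  | qf {n : ℕ} (θ : QFFormula L n) : PrenexFormula k L n
  | app {n : ℕ} (i : ℕ) (v : List (Fin n)) (φ : PrenexFormula k L (n + 1)) : PrenexFormula k L n
  | ex {n : ℕ} (φ : PrenexFormula k L (n + 1)) : PrenexFormula k L n
  | all {n : ℕ} (φ : PrenexFormula k L (n + 1)) : PrenexFormula k L n
  | quant {n : ℕ} (φ : PrenexFormula k L (n + k)) : PrenexFormula k L n

def PrenexFormula.Sat (Q : GenQuantifier.{w} k) [L.Structure M] (F : FunVal M) :
    {n : ℕ} → PrenexFormula k L n → (Fin n → M) → Prop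
  | _, .qf θ, s => θ.Realize s
  | _, .app i v φ, s => φ.Sat Q F (Fin.snoc s (F i (v.map s)))
  | _, .ex φ, s => ∃ a : M, φ.Sat Q F (Fin.snoc s a)
  | _, .all φ, s => ∀ a : M, φ.Sat Q F (Fin.snoc s a)
  | _, .quant φ, s => {a : Fin k → M | φ.Sat Q F (Fin.append s a)} ∈ Q M

/-- The quantifier `Q` if `b` is true, and the empty quantifier otherwise. -/
def GenQuantifier.restrict (Q : GenQuantifier.{w} k) (b : Bool) : GenQuantifier.{w} k :=
  fun M => {A | b = true ∧ A ∈ Q M}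

/-- The prenex form of the result of putting `φ`, with its variables renamed by `ρ`, in the context
`K`, which is given as a function of the quantifier-free matrix of `φ`. If `b` is false, then the
subformulas that begin with `Q` are replaced by a contradiction. -/
def FunFormula.prenex (b : Bool) : {n : ℕ} → FunFormula k L n → {N : ℕ} → (Fin n → Fin N) →
    (K : (N' : ℕ) → (Fin N → Fin N') → QFFormula L N' → PrenexFormula k L N') →
    PrenexFormula k L N
  | _, .lit l, N, ρ, K => K N id (.lit (l.map (LHom.id L) ρ))
  | _, .eqn i v y, N, ρ, K => .app i (v.map ρ)
      (K (N + 1) Fin.castSucc (.lit (.eq (.var (Fin.last N)) (.var (ρ y).castSucc))))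
  | _, .and φ ψ, _, ρ, K => φ.prenex b ρ fun _ ι₁ θ₁ => ψ.prenex b (ι₁ ∘ ρ) fun N₂ ι₂ θ₂ =>
      K N₂ (ι₂ ∘ ι₁) (.and (θ₁.rename ι₂) θ₂)
  | _, .or φ ψ, _, ρ, K => φ.prenex b ρ fun _ ι₁ θ₁ => ψ.prenex b (ι₁ ∘ ρ) fun N₂ ι₂ θ₂ =>
      K N₂ (ι₂ ∘ ι₁) (.or (θ₁.rename ι₂) θ₂)
  | _, .ex φ, N, ρ, K => .ex (φ.prenex b (Fin.snoc (Fin.castSucc ∘ ρ) (Fin.last N))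
      fun N' ι θ => K N' (ι ∘ Fin.castSucc) θ)
  | _, .all φ, N, ρ, K => .all (φ.prenex b (Fin.snoc (Fin.castSucc ∘ ρ) (Fin.last N))
      fun N' ι θ => K N' (ι ∘ Fin.castSucc) θ)
  | _, .quant φ, N, ρ, K =>
    if b then .quant (φ.prenex b (Fin.append (Fin.castAdd k ∘ ρ) (Fin.natAdd N))
      fun N' ι θ => K N' (ι ∘ Fin.castAdd k) θ)
    else .ex (K (N + 1) Fin.castSucc (.lit (.ne (.var (Fin.last N)) (.var (Fin.last N)))))

theorem Fin.snoc_comp_snoc {α : Type*} {n N : ℕ} (s : Fin N → α) (a : α) (ρ : Fin n → Fin N) :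
    ((Fin.snoc s a : Fin (N + 1) → α) ∘
      (Fin.snoc (Fin.castSucc ∘ ρ) (Fin.last N) : Fin (n + 1) → Fin (N + 1))) =
      Fin.snoc (s ∘ ρ) a := by
  funext i
  refine Fin.lastCases ?_ (fun j => ?_) i <;> simp

theorem Fin.append_comp_append {α : Type*} {n N k : ℕ} (s : Fin N → α) (a : Fin k → α)
    (ρ : Fin n → Fin N) :
    Fin.append s a ∘ Fin.append (Fin.castAdd k ∘ ρ) (Fin.natAdd N) = Fin.append (s ∘ ρ) a := by
  funext i
  refine Fin.addCases (fun j => ?_) (fun j => ?_) i <;> simp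

/-- The operator `C s` is the meaning of the context `K`. Being monotone on propositions, it is
constant or the identity. The identity passes through every quantifier; a constant passes through ∃
and ∀ because M is nonempty, and through Q because ∅ ∉ Q_M and M^k ∈ Q_M. -/
theorem FunFormula.sat_prenex (Q : GenQuantifier.{w} k) [Nonempty M] [L.Structure M] {b : Bool}
    (hempty : ∅ ∉ Q M) (htop : b = true → Set.univ ∈ Q M) (F : FunVal M) {n : ℕ}
    (φ : FunFormula k L n) {N : ℕ} (ρ : Fin n → Fin N)
    (K : (N' : ℕ) → (Fin N → Fin N') → QFFormula L N' → PrenexFormula k L N')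
    (C : (Fin N → M) → Prop → Prop) (hC : ∀ s, Monotone (C s))
    (hK : ∀ N' ι θ s, (K N' ι θ).Sat Q F s ↔ C (s ∘ ι) (θ.Realize s)) (s : Fin N → M) :
    (φ.prenex b ρ K).Sat Q F s ↔ C s (φ.Sat (Q.restrict b) F (s ∘ ρ)) := by
  induction φ generalizing N with
  | lit l =>
    rw [prenex, hK, QFFormula.Realize, Literal.realize_map]
    rfl
  | eqn i v y =>
    rw [prenex, PrenexFormula.Sat, hK, QFFormula.Realize, Literal.Realize]
    simp [FunFormula.Sat]
  | and φ ψ ih₁ ih₂ =>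
    -- While φ is processed, ψ belongs to the context; while ψ is processed, the matrix obtained
    -- from φ does.
    rw [prenex, ih₁ (C := fun s p => C s (p ∧ ψ.Sat (Q.restrict b) F (s ∘ ρ)))]
    · rfl
    · exact fun s p q h => hC s (And.imp_left h)
    · intro N₁ ι₁ θ₁ s₁
      rw [ih₂ (C := fun s p => C (s ∘ ι₁) (θ₁.Realize s ∧ p))]
      · rfl
      · exact fun s p q h => hC _ (And.imp_right h)
      · intro N₂ ι₂ θ₂ s₂
        rw [hK, QFFormula.Realize, QFFormula.realize_rename]
        rfl
  | or φ ψ ih₁ ih₂ =>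
    rw [prenex, ih₁ (C := fun s p => C s (p ∨ ψ.Sat (Q.restrict b) F (s ∘ ρ)))]
    · rfl
    · exact fun s p q h => hC s (Or.imp_left h)
    · intro N₁ ι₁ θ₁ s₁
      rw [ih₂ (C := fun s p => C (s ∘ ι₁) (θ₁.Realize s ∨ p))]
      · rfl
      · exact fun s p q h => hC _ (Or.imp_right h)
      · intro N₂ ι₂ θ₂ s₂
        rw [hK, QFFormula.Realize, QFFormula.realize_rename]
        rfl
  | ex φ ih =>
    rw [prenex, PrenexFormula.Sat, FunFormula.Sat]
    have key (a : M) := ih (Fin.snoc (Fin.castSucc ∘ ρ) (Fin.last N))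
      (fun N' ι θ => K N' (ι ∘ Fin.castSucc) θ) (fun s p => C (s ∘ Fin.castSucc) p)
      (fun s => hC _) (fun N' ι θ s => hK _ _ _ _) (Fin.snoc s a)
    simp only [key, Fin.snoc_comp_snoc, Fin.snoc_comp_castSucc']
    constructor
    · rintro ⟨a, ha⟩
      exact hC s (fun h => ⟨a, h⟩) ha
    · intro h
      by_cases h' : ∃ a, φ.Sat (Q.restrict b) F (Fin.snoc (s ∘ ρ) a)
      · obtain ⟨a, ha⟩ := h'
        exact ⟨a, hC s (fun _ => ha) h⟩
      · exact ⟨Classical.arbitrary M, hC s (fun h => absurd h h') h⟩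
  | all φ ih =>
    rw [prenex, PrenexFormula.Sat, FunFormula.Sat]
    have key (a : M) := ih (Fin.snoc (Fin.castSucc ∘ ρ) (Fin.last N))
      (fun N' ι θ => K N' (ι ∘ Fin.castSucc) θ) (fun s p => C (s ∘ Fin.castSucc) p)
      (fun s => hC _) (fun N' ι θ s => hK _ _ _ _) (Fin.snoc s a)
    simp only [key, Fin.snoc_comp_snoc, Fin.snoc_comp_castSucc']
    constructor
    · intro h
      by_cases h' : ∀ a, φ.Sat (Q.restrict b) F (Fin.snoc (s ∘ ρ) a)
      · exact hC s (fun _ => h') (h (Classical.arbitrary M))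
      · push Not at h'
        obtain ⟨a, ha⟩ := h'
        exact hC s (fun h => absurd h ha) (h a)
    · exact fun h a => hC s (fun h => h a) h
  | quant φ ih =>
    rw [prenex, FunFormula.Sat]
    split_ifs with hb
    · have key (a : Fin k → M) := ih (Fin.append (Fin.castAdd k ∘ ρ) (Fin.natAdd N))
        (fun N' ι θ => K N' (ι ∘ Fin.castAdd k) θ) (fun s p => C (s ∘ Fin.castAdd k) p)
        (fun s => hC _) (fun N' ι θ s => hK _ _ _ _) (Fin.append s a)
      simp only [PrenexFormula.Sat, key, Fin.append_comp_append, Fin.append_comp_castAdd,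
        GenQuantifier.restrict]
      set A := {a | φ.Sat (Q.restrict b) F (Fin.append (s ∘ ρ) a)} with hA
      change {a | C s (a ∈ A)} ∈ Q M ↔ C s (b = true ∧ A ∈ Q M)
      simp only [hb, true_and]
      by_cases h₀ : C s False
      · have h₁ (p : Prop) : C s p := hC s False.elim h₀
        simp only [h₁, iff_true]
        exact htop hb
      · by_cases h₁ : C s True
        · have h₂ (p : Prop) : C s p ↔ p := by
            by_cases hp : p <;> simp [hp, h₀, h₁]
          simp only [h₂]
          rfl
        · have h₂ (p : Prop) : ¬ C s p := fun h => h₁ (hC s (fun _ => trivial) h)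
          simp only [h₂, iff_false]
          exact hempty
    -- The leading ∃ only supplies a variable for the contradiction x ≠ x, since N may be 0.
    · simp only [PrenexFormula.Sat, hK, Fin.snoc_comp_castSucc', QFFormula.Realize,
        Literal.Realize, ne_eq, not_true_eq_false, GenQuantifier.restrict]
      simp [hb]

/-! ### Function variables expressed by dependence atoms -/

/-- The equation `f(v) = y` for the function variable `f` with the given index. -/
structure FunEqn (n : ℕ) where
  index : ℕ
  args : List (Fin n)
  value : Fin n

def FunEqn.rename {n m : ℕ} (ρ : Fin n → Fin m) (e : FunEqn n) : FunEqn m :=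
  ⟨e.index, e.args.map ρ, ρ e.value⟩

def FunEqn.Realize {n : ℕ} (F : FunVal M) (e : FunEqn n) (s : Fin n → M) : Prop :=
  F e.index (e.args.map s) = s e.value

theorem FunEqn.realize_rename {n m : ℕ} (F : FunVal M) (ρ : Fin n → Fin m) (e : FunEqn n)
    (s : Fin m → M) : (e.rename ρ).Realize F s ↔ e.Realize F (s ∘ ρ) := by
  simp [FunEqn.rename, FunEqn.Realize]

namespace DFormula

/-- A valid formula. -/
def verum (n : ℕ) : DFormula k L n := .all (.lit (.eq (.var (Fin.last n)) (.var (Fin.last n))))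

theorem sat_verum (Q : GenQuantifier.{w} k) [L.Structure M] {n : ℕ} (X : Team M n) :
    (verum n : DFormula k L n).Sat Q X :=
  fun _ _ => rfl

def ands {n : ℕ} : List (DFormula k L n) → DFormula k L n
  | [] => verum n
  | φ :: l => .and φ (ands l)

theorem sat_ands (Q : GenQuantifier.{w} k) [L.Structure M] {n : ℕ} (l : List (DFormula k L n))
    (X : Team M n) : (ands l).Sat Q X ↔ ∀ φ ∈ l, φ.Sat Q X := by
  induction l with
  | nil => simp [ands, sat_verum]
  | cons φ l ih => simp [ands, Sat, ih]

def alls {n : ℕ} : (m : ℕ) → DFormula k L (n + m) → DFormula k L n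
  | 0, φ => φ
  | m + 1, φ => alls m (.all φ)

theorem sat_alls (Q : GenQuantifier.{w} k) [L.Structure M] {n m : ℕ} (φ : DFormula k L (n + m))
    (X : Team M n) :
    (alls m φ).Sat Q X ↔ φ.Sat Q {t | ∃ s ∈ X, ∃ a : Fin m → M, t = Fin.append s a} := by
  induction m with
  | zero =>
    rw [alls]
    have : X = {t | ∃ s ∈ X, ∃ a : Fin 0 → M, t = Fin.append s a} := by
      ext s
      constructor
      · exact fun h => ⟨s, h, Fin.elim0, by funext i; exact (Fin.append_left s _ i).symm⟩
      · rintro ⟨s', h, a, rfl⟩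
        convert h
        funext i; exact Fin.append_left s' a i
    rw [← this]
  | succ m ih =>
    rw [alls, ih, Sat]
    have (X : Team M n) : Team.duplicate {t | ∃ s ∈ X, ∃ a : Fin m → M, t = Fin.append s a} =
        {t : Fin (n + (m + 1)) → M | ∃ s ∈ X, ∃ a : Fin (m + 1) → M, t = Fin.append s a} := by
      ext t
      constructor
      · rintro ⟨_, ⟨s, hs, a, rfl⟩, b, rfl⟩
        exact ⟨s, hs, Fin.snoc a b, (Fin.append_snoc _ _ _).symm⟩
      · rintro ⟨s, hs, a, rfl⟩
        refine ⟨_, ⟨s, hs, Fin.init a, rfl⟩, a (Fin.last m), ?_⟩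
        rw [← Fin.append_snoc, Fin.snoc_init_self]
    rw [this]

end DFormula

/-- The formula `v ≠ v'`, or `y = y'`. -/
def QFFormula.congrEq {n : ℕ} (v v' : List (Fin n)) (y y' : Fin n) : QFFormula L n :=
  ors (.lit (.eq (.var y) (.var y')))
    (List.zipWith (fun x x' => .lit (.ne (.var x) (.var x'))) v v')

/-- Equal lengths are needed because `List.zipWith` stops at the end of the shorter list. -/
theorem QFFormula.realize_congrEq [L.Structure M] {n : ℕ} {v v' : List (Fin n)}
    (hv : v.length = v'.length) (y y' : Fin n) (s : Fin n → M) :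
    (congrEq (L := L) v v' y y').Realize s ↔ (v.map s = v'.map s → s y = s y') := by
  rw [congrEq, realize_ors]
  have : (∃ ψ ∈ List.zipWith (fun x x' => (lit (.ne (.var x) (.var x')) : QFFormula L n)) v v',
      ψ.Realize s) ↔ ¬ v.map s = v'.map s := by
    induction v generalizing v' with
    | nil =>
      obtain rfl := List.length_eq_zero_iff.1 hv.symm
      simp
    | cons x v ih =>
      obtain _ | ⟨x', v'⟩ := v'
      · simp at hv
      · have := ih (v' := v') (by simpa using hv)
        simp only [List.zipWith_cons_cons, List.exists_mem_cons_iff, this, List.map_cons,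
          List.cons.injEq, not_and_or]
        rfl
  rw [this, imp_iff_not_or]
  rfl

/-- This reads one conjunct of `FunEqn.coherence`: the variables are those of s, then an argument
tuple a, then the proposed value b of the function at a. -/
theorem QFFormula.realize_congrEq_append [L.Structure M] {n m : ℕ} {v : List (Fin n)}
    (hv : v.length = m) (y : Fin n) (s : Fin n → M) (a : Fin m → M) (b : M) :
    (congrEq (L := L) (v.map fun i => (Fin.castAdd m i).castSucc)
      (List.ofFn fun i : Fin m => (Fin.natAdd n i).castSucc) (Fin.castAdd m y).castSucc
      (Fin.last (n + m))).Realize (Fin.snoc (Fin.append s a) b : Fin (n + m + 1) → M) ↔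
      (v.map s = List.ofFn a → s y = b) := by
  rw [realize_congrEq (by simpa using hv)]
  simp only [List.map_map, List.map_ofFn, Function.comp_def, Fin.snoc_castSucc, Fin.append_left,
    Fin.append_right, Fin.snoc_last]

/-- The formula of `D(Q)` that says that a team determines, for each of two equations
`f(v) = y` and `f(v') = y'`, the value of `f`, and that both give the same values. -/
def FunEqn.coherence {n : ℕ} (e e' : FunEqn n) : DFormula k L n :=
  let m := e.args.length
  let z : List (Fin (n + m + 1)) := List.ofFn fun i : Fin m => (Fin.natAdd n i).castSucc
  .alls m (.ex (.and
    (.dep (fun i : Fin m => .var (Fin.natAdd n i).castSucc) (.var (Fin.last (n + m))))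
    (QFFormula.and
      (.congrEq (e.args.map fun i => (Fin.castAdd m i).castSucc) z
        (Fin.castAdd m e.value).castSucc (Fin.last (n + m)))
      (.congrEq (e'.args.map fun i => (Fin.castAdd m i).castSucc) z
        (Fin.castAdd m e'.value).castSucc (Fin.last (n + m)))).toD))

theorem FunEqn.eq_of_sat_coherence {Q : GenQuantifier.{w} k} [L.Structure M] {n : ℕ}
    {e e' : FunEqn n} {X : Team M n} (h : (e.coherence e' : DFormula k L n).Sat Q X)
    {s s' : Fin n → M} (hs : s ∈ X) (hs' : s' ∈ X) (hv : e.args.map s = e'.args.map s') :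
    s e.value = s' e'.value := by
  have hlen : e'.args.length = e.args.length := by simpa using congrArg List.length hv.symm
  rw [coherence, DFormula.sat_alls] at h
  obtain ⟨f, hdep, hf⟩ := h
  rw [QFFormula.sat_toD] at hf
  have ha : e.args.map s = List.ofFn fun i => s (e.args.get i) := by
    conv_lhs => rw [← List.ofFn_get e.args, List.map_ofFn]
    rfl
  -- Both s and s' are extended by the same tuple, the common value of the two argument lists. The
  -- dependence atom then forces the same last value on both extensions.
  have hmem (s : Fin n → M) (hs : s ∈ X) (a : Fin e.args.length → M) :=
    (Team.mem_supplement _ f (Fin.append s a) _).2 ⟨⟨s, hs, a, rfl⟩, rfl⟩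
  have h₁ := (QFFormula.realize_congrEq_append rfl _ _ _ _).1 (hf _ (hmem s hs _)).1 ha
  have h₂ := (QFFormula.realize_congrEq_append hlen _ _ _ _).1 (hf _ (hmem s' hs' _)).2
    (hv.symm.trans ha)
  have h₃ := hdep _ (hmem s hs fun i => s (e.args.get i)) _
    (hmem s' hs' fun i => s (e.args.get i)) fun i => by
      simp only [Term.realize, Fin.snoc_castSucc, Fin.append_right]
  simp only [Term.realize, Fin.snoc_last] at h₃
  rw [h₁, h₂, h₃]

theorem FunEqn.sat_coherence (Q : GenQuantifier.{w} k) [L.Structure M] {n : ℕ}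
    {e e' : FunEqn n} (hlen : e.args.length = e'.args.length) (hi : e.index = e'.index)
    {X : Team M n} (F : FunVal M) (h : ∀ s ∈ X, e.Realize F s) (h' : ∀ s ∈ X, e'.Realize F s) :
    (e.coherence e' : DFormula k L n).Sat Q X := by
  rw [coherence, DFormula.sat_alls]
  -- The last variable receives the value of the function at the universally quantified tuple, so it
  -- is determined by that tuple alone.
  refine ⟨fun t => F e.index (List.ofFn fun i => t.1 (Fin.natAdd n i)), ?_, ?_⟩
  · rintro _ ⟨s, rfl⟩ _ ⟨s', rfl⟩ hss
    simp only [Term.realize, Fin.snoc_castSucc, Fin.snoc_last] at hss ⊢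
    simp only [hss]
  · rw [QFFormula.sat_toD]
    rintro _ ⟨⟨_, s, hs, a, rfl⟩, rfl⟩
    simp only [Fin.append_right]
    refine ⟨(QFFormula.realize_congrEq_append rfl _ _ _ _).2 fun hv => ?_,
      (QFFormula.realize_congrEq_append hlen.symm _ _ _ _).2 fun hv => ?_⟩
    · rw [← hv]
      exact (h s hs).symm
    · rw [← hv, hi]
      exact (h' s hs).symm

open Classical in
/-- The formula of `D(Q)` that says that a team satisfies the equations in `E` for some values of
the function variables. -/
def FunEqn.system {n : ℕ} (E : List (FunEqn n)) : DFormula k L n :=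
  .ands (((E.product E).filter fun p =>
    p.1.args.length = p.2.args.length ∧ p.1.index = p.2.index).map fun p => p.1.coherence p.2)

/-- Pairwise coherence suffices: a system of equations defines functions as soon as no two of its
instances over the team prescribe different values at the same argument. Pairs of an equation with
itself are included, to compare different assignments. -/
theorem FunEqn.sat_system (Q : GenQuantifier.{w} k) [Nonempty M] [L.Structure M] {n : ℕ}
    (E : List (FunEqn n)) (X : Team M n) :
    (FunEqn.system E : DFormula k L n).Sat Q X ↔
      ∃ F : FunVal M, ∀ s ∈ X, ∀ e ∈ E, e.Realize F s := by
  classical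
  simp only [system, DFormula.sat_ands, List.forall_mem_map, List.mem_filter, Prod.forall,
    List.pair_mem_product, decide_eq_true_eq]
  constructor
  · intro h
    -- The value at (i, l) is any value that some equation of E prescribes there at some assignment
    -- of X, and arbitrary if there is none.
    refine ⟨fun i l => if h : ∃ a, ∃ s ∈ X, ∃ e ∈ E, e.index = i ∧ e.args.map s = l ∧
      s e.value = a then h.choose else Classical.arbitrary M, fun s hs e he => ?_⟩
    have hex : ∃ a, ∃ s' ∈ X, ∃ e' ∈ E, e'.index = e.index ∧ e'.args.map s' = e.args.map s ∧
      s' e'.value = a := ⟨_, s, hs, e, he, rfl, rfl, rfl⟩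
    rw [FunEqn.Realize, dif_pos hex]
    obtain ⟨s', hs', e', he', hi, hv, ha⟩ := hex.choose_spec
    rw [← ha]
    refine eq_of_sat_coherence (h e' e ⟨⟨he', he⟩, ?_, hi⟩) hs' hs hv
    simpa using congrArg List.length hv
  · rintro ⟨F, hF⟩ e e' ⟨⟨he, he'⟩, hlen, hi⟩
    exact sat_coherence Q hlen hi F (fun s hs => hF s hs e he) fun s hs => hF s hs e' he'

/-- The formula of `D(Q)` that says that a team satisfies `φ` and the equations in `E` for some
values of the function variables. -/
def PrenexFormula.toD : {n : ℕ} → PrenexFormula k L n → List (FunEqn n) → DFormula k L n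
  | _, .qf θ, E => .and θ.toD (FunEqn.system E)
  | n, .app i v φ, E => .ex (φ.toD (⟨i, v.map Fin.castSucc, Fin.last n⟩ ::
      E.map (FunEqn.rename Fin.castSucc)))
  | _, .ex φ, E => .ex (φ.toD (E.map (FunEqn.rename Fin.castSucc)))
  | _, .all φ, E => .all (φ.toD (E.map (FunEqn.rename Fin.castSucc)))
  | _, .quant φ, E => .quant (φ.toD (E.map (FunEqn.rename (Fin.castAdd k))))

/-- One F has to serve the whole team, which is why its equations are collected in E and tested only
on the final team. Once F is fixed, the condition is flat, and the choices for ∃ and Q are made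
separately at each assignment. -/
theorem PrenexFormula.sat_toD (Q : GenQuantifier.{w} k) (hQ : Q.MonotoneIncreasing) [Nonempty M]
    (hempty : ∅ ∉ Q M) [L.Structure M] {n : ℕ} (φ : PrenexFormula k L n) (E : List (FunEqn n))
    (X : Team M n) :
    (φ.toD E).Sat Q X ↔
      ∃ F : FunVal M, ∀ s ∈ X, φ.Sat Q F s ∧ ∀ e ∈ E, e.Realize F s := by
  induction φ with
  | qf θ =>
    simp only [toD, DFormula.Sat, QFFormula.sat_toD, FunEqn.sat_system]
    constructor
    · rintro ⟨h, F, hF⟩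
      exact ⟨F, fun s hs => ⟨h s hs, hF s hs⟩⟩
    · rintro ⟨F, hF⟩
      exact ⟨fun s hs => (hF s hs).1, F, fun s hs => (hF s hs).2⟩
  | app i v φ ih =>
    simp only [toD, DFormula.Sat, ih, List.forall_mem_cons, List.forall_mem_map,
      FunEqn.realize_rename]
    constructor
    · rintro ⟨f, F, hF⟩
      refine ⟨F, fun s hs => ?_⟩
      obtain ⟨h₁, h₂, h₃⟩ := hF _ ⟨⟨s, hs⟩, rfl⟩
      rw [Fin.snoc_comp_castSucc'] at h₃
      simp only [FunEqn.Realize, List.map_map, Fin.snoc_comp_castSucc', Fin.snoc_last] at h₂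
      rw [← h₂] at h₁
      exact ⟨h₁, h₃⟩
    · rintro ⟨F, hF⟩
      refine ⟨fun s => F i (v.map s.1), F, ?_⟩
      rintro _ ⟨⟨s, hs⟩, rfl⟩
      refine ⟨(hF s hs).1, ?_, ?_⟩
      · simp only [FunEqn.Realize, List.map_map, Fin.snoc_comp_castSucc', Fin.snoc_last]
      · rw [Fin.snoc_comp_castSucc']
        exact (hF s hs).2
  | ex φ ih =>
    simp only [toD, DFormula.Sat, ih, List.forall_mem_map, FunEqn.realize_rename, Sat]
    constructor
    · rintro ⟨f, F, hF⟩
      refine ⟨F, fun s hs => ?_⟩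
      obtain ⟨h₁, h₂⟩ := hF _ ⟨⟨s, hs⟩, rfl⟩
      rw [Fin.snoc_comp_castSucc'] at h₂
      exact ⟨⟨_, h₁⟩, h₂⟩
    · rintro ⟨F, hF⟩
      choose! f hf using fun s hs => (hF s hs).1
      refine ⟨fun s => f s.1, F, ?_⟩
      rintro _ ⟨⟨s, hs⟩, rfl⟩
      rw [Fin.snoc_comp_castSucc']
      exact ⟨hf s hs, (hF s hs).2⟩
  | all φ ih =>
    simp only [toD, DFormula.Sat, ih, List.forall_mem_map, FunEqn.realize_rename, Sat]
    refine exists_congr fun F => ⟨fun h s hs => ⟨fun a => ?_, ?_⟩, ?_⟩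
    · exact (h _ ⟨s, hs, a, rfl⟩).1
    -- The equations in E concern s alone, but are known only for extensions of s; nonemptiness of M
    -- provides one.
    · have := (h _ ⟨s, hs, Classical.arbitrary M, rfl⟩).2
      rwa [Fin.snoc_comp_castSucc'] at this
    · rintro h _ ⟨s, hs, a, rfl⟩
      rw [Fin.snoc_comp_castSucc']
      exact ⟨(h s hs).1 a, (h s hs).2⟩
  | quant φ ih =>
    simp only [toD, DFormula.Sat, ih, List.forall_mem_map, FunEqn.realize_rename, Sat]
    constructor
    · rintro ⟨G, hG, F, hF⟩
      refine ⟨F, fun s hs => ?_⟩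
      have key (a : Fin k → M) (ha : a ∈ G ⟨s, hs⟩) := hF _ ⟨⟨s, hs⟩, a, ha, rfl⟩
      simp only [Fin.append_comp_castAdd] at key
      refine ⟨hQ M _ _ (fun a ha => (key a ha).1) (hG ⟨s, hs⟩), ?_⟩
      -- Here ∅ ∉ Q_M guarantees that s has an extension in the new team, from which its equations
      -- are recovered.
      obtain ⟨a, ha⟩ : (G ⟨s, hs⟩).Nonempty := Set.nonempty_iff_ne_empty.2 fun h =>
        hempty (h ▸ hG ⟨s, hs⟩)
      exact (key a ha).2
    · rintro ⟨F, hF⟩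
      refine ⟨fun s => {a | φ.Sat Q F (Fin.append s.1 a)}, fun s => (hF _ s.2).1, F, ?_⟩
      rintro _ ⟨⟨s, hs⟩, a, ha, rfl⟩
      rw [Fin.append_comp_castAdd]
      exact ⟨ha, (hF s hs).2⟩

end Prenex

/-! ### Elimination of second-order symbols in favour of function variables -/

section ESOToFun

variable {k : ℕ} {L L' : FirstOrder.Language.{u, v}} {M : Type w}

namespace FunFormula

def verum (n : ℕ) : FunFormula k L n := .all (.lit (.eq (.var (Fin.last n)) (.var (Fin.last n))))

def ands {n : ℕ} : List (FunFormula k L n) → FunFormula k L n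
  | [] => verum n
  | φ :: l => .and φ (ands l)

theorem sat_ands (Q : GenQuantifier.{w} k) [L.Structure M] (F : FunVal M) {n : ℕ}
    (l : List (FunFormula k L n)) (s : Fin n → M) :
    (ands l).Sat Q F s ↔ ∀ φ ∈ l, φ.Sat Q F s := by
  induction l with
  | nil => simp [ands, verum, Sat, Literal.Realize]
  | cons φ l ih => simp [ands, Sat, ih]

def exs {n : ℕ} : (m : ℕ) → FunFormula k L (n + m) → FunFormula k L n
  | 0, φ => φ
  | m + 1, φ => exs m (.ex φ)

theorem sat_exs (Q : GenQuantifier.{w} k) [L.Structure M] (F : FunVal M) {n m : ℕ}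
    (φ : FunFormula k L (n + m)) (s : Fin n → M) :
    (exs m φ).Sat Q F s ↔ ∃ a : Fin m → M, φ.Sat Q F (Fin.append s a) := by
  induction m with
  | zero =>
    have h (a : Fin 0 → M) : Fin.append s a = s := funext fun i => Fin.append_left s a i
    simp only [exs, h, exists_const]
  | succ m ih =>
    rw [exs, ih]
    constructor
    · rintro ⟨a, b, h⟩
      exact ⟨Fin.snoc a b, by rwa [← Fin.append_snoc] at h⟩
    · rintro ⟨a, h⟩
      refine ⟨Fin.init a, a (Fin.last m), ?_⟩
      rwa [← Fin.append_snoc, Fin.snoc_init_self]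

end FunFormula

/-- An interpretation of the symbols of `L'` by symbols of `L` or by function variables. If it sends
a function symbol `f` to the pair `(i, j)`, then `f(a)` stands for the value of the variable `i` at
`(x_0, …, x_{j-1}, a)`; if it sends a relation symbol `R` to `(i, j)`, then `R(a)` says that the
variables `i` and `i + 1` have the same value at `(x_0, …, x_{j-1}, a)`. -/
structure SymbolEnv (L L' : FirstOrder.Language.{u, v}) where
  func : ∀ {m}, L'.Functions m → L.Functions m ⊕ ℕ × ℕ
  rel : ∀ {m}, L'.Relations m → L.Relations m ⊕ ℕ × ℕ

namespace SymbolEnv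

variable (e : SymbolEnv L L')

/-- This is the freshness condition: function variables from `c` on are unused, and only the first
`n` values of the assignment enter as extra arguments. The `+ 1` for relations accounts for the
second variable of the pair. -/
structure Bounded (n c : ℕ) : Prop where
  func {m : ℕ} (f : L'.Functions m) (p : ℕ × ℕ) : e.func f = .inr p → p.1 < c ∧ p.2 ≤ n
  rel {m : ℕ} (R : L'.Relations m) (p : ℕ × ℕ) : e.rel R = .inr p → p.1 + 1 < c ∧ p.2 ≤ n

theorem Bounded.mono {e : SymbolEnv L L'} {n c n' c' : ℕ} (h : e.Bounded n c) (hn : n ≤ n')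
    (hc : c ≤ c') : e.Bounded n' c' where
  func f p hp := ⟨(h.func f p hp).1.trans_le hc, (h.func f p hp).2.trans hn⟩
  rel R p hp := ⟨(h.rel R p hp).1.trans_le hc, (h.rel R p hp).2.trans hn⟩

/-- The structure `S'` interprets the symbols of `L'` as prescribed by the values `F` of the function
variables and the assignment `s`. -/
structure Compat [S : L.Structure M] (S' : L'.Structure M) (F : FunVal M) {n : ℕ}
    (s : Fin n → M) : Prop where
  func {m : ℕ} (f : L'.Functions m) (a : Fin m → M) :
    S'.funMap f a = (e.func f).elim (fun g => S.funMap g a)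
      fun p => F p.1 ((List.ofFn s).take p.2 ++ List.ofFn a)
  rel {m : ℕ} (R : L'.Relations m) (a : Fin m → M) :
    S'.RelMap R a ↔ (e.rel R).elim (fun P => S.RelMap P a)
      fun p => F p.1 ((List.ofFn s).take p.2 ++ List.ofFn a) =
        F (p.1 + 1) ((List.ofFn s).take p.2 ++ List.ofFn a)

variable {e}

/-- A bounded environment sees only the variables below `c` and prefixes of length at most `n`, so
new indices may be revalued and the assignment extended. -/
theorem Compat.congr [L.Structure M] {S' : L'.Structure M} {F F' : FunVal M} {n n' c : ℕ}
    {s : Fin n → M} {s' : Fin n' → M} (h : e.Compat S' F s) (hb : e.Bounded n c)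
    (hF : ∀ i < c, F' i = F i) (hs : ∀ j ≤ n, (List.ofFn s').take j = (List.ofFn s).take j) :
    e.Compat S' F' s' where
  func f a := by
    rw [h.func]
    cases hf : e.func f with
    | inl g => rfl
    | inr p =>
      obtain ⟨h₁, h₂⟩ := hb.func f p hf
      simp only [Sum.elim_inr, hF _ h₁, hs _ h₂]
  rel R a := by
    rw [h.rel]
    cases hf : e.rel R with
    | inl g => rfl
    | inr p =>
      obtain ⟨h₁, h₂⟩ := hb.rel R p hf
      simp only [Sum.elim_inr, hF _ h₁, hF p.1 (by omega), hs _ h₂]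

theorem Compat.append [L.Structure M] {S' : L'.Structure M} {F : FunVal M} {n m c : ℕ}
    {s : Fin n → M} (h : e.Compat S' F s) (hb : e.Bounded n c) (a : Fin m → M) :
    e.Compat S' F (Fin.append s a) := by
  refine h.congr hb (fun _ _ => rfl) fun j hj => ?_
  rw [List.ofFn_fin_append, List.take_append_of_le_length (by simpa using hj)]

theorem Compat.snoc [L.Structure M] {S' : L'.Structure M} {F : FunVal M} {n c : ℕ}
    {s : Fin n → M} (h : e.Compat S' F s) (hb : e.Bounded n c) (a : M) :
    e.Compat S' F (Fin.snoc s a : Fin (n + 1) → M) := by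
  rw [← Fin.append_right_eq_snoc s fun _ => a]
  exact h.append hb _

/-- The extension that interprets a new function symbol by the variable `c`. -/
def addFun (e : SymbolEnv L L') (n c m : ℕ) : SymbolEnv L (addFun L' m) where
  func f := match f with
    | .old f => e.func f
    | .new => .inr (c, n)
  rel R := e.rel (m := _) R

/-- The extension that interprets a new relation symbol by the variables `c` and `c + 1`. -/
def addRel (e : SymbolEnv L L') (n c m : ℕ) : SymbolEnv L (addRel L' m) where
  func f := e.func (m := _) f
  rel R := match R with
    | .old R => e.rel R
    | .new => .inr (c, n)

theorem Bounded.addFun {n c : ℕ} (h : e.Bounded n c) (m : ℕ) :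
    (e.addFun n c m).Bounded n (c + 1) where
  func f p hp := by
    cases f with
    | old f => exact (h.mono le_rfl c.le_succ).func f p hp
    | new =>
      obtain rfl : (c, n) = p := Sum.inr_injective hp
      simp
  rel R p hp := (h.mono le_rfl c.le_succ).rel (m := _) R p hp

theorem Bounded.addRel {n c : ℕ} (h : e.Bounded n c) (m : ℕ) :
    (e.addRel n c m).Bounded n (c + 2) where
  func f p hp := (h.mono le_rfl (Nat.le_add_right c 2)).func (m := _) f p hp
  rel R p hp := by
    cases R with
    | old R => exact (h.mono le_rfl (Nat.le_add_right c 2)).rel R p hp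
    | new =>
      obtain rfl : (c, n) = p := Sum.inr_injective hp
      simp

theorem Compat.addFun [L.Structure M] {S' : L'.Structure M} {F : FunVal M} {n m : ℕ}
    {s : Fin n → M} (h : e.Compat S' F s) (c : ℕ) {f : (Fin m → M) → M}
    (hf : ∀ a, f a = F c (List.ofFn s ++ List.ofFn a)) :
    (e.addFun n c m).Compat (expandFun S' f) F s where
  func g a := by
    cases g with
    | old g => exact h.func g a
    | new =>
      change f a = F c ((List.ofFn s).take n ++ List.ofFn a)
      rw [hf, List.take_of_length_le (by simp)]
  rel R a := h.rel (m := _) R a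

theorem Compat.addRel [L.Structure M] {S' : L'.Structure M} {F : FunVal M} {n m : ℕ}
    {s : Fin n → M} (h : e.Compat S' F s) (c : ℕ) {R : (Fin m → M) → Prop}
    (hR : ∀ a, R a ↔ F c (List.ofFn s ++ List.ofFn a) = F (c + 1) (List.ofFn s ++ List.ofFn a)) :
    (e.addRel n c m).Compat (expandRel S' R) F s where
  func f a := h.func (m := _) f a
  rel P a := by
    cases P with
    | old P => exact h.rel P a
    | new =>
      change R a ↔ F c ((List.ofFn s).take n ++ List.ofFn a) =
        F (c + 1) ((List.ofFn s).take n ++ List.ofFn a)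
      rw [hR, List.take_of_length_le (by simp)]

/-- The list `x_{ρ 0}, …, x_{ρ (j-1)}, x_{w 0}, …, x_{w (m-1)}`. -/
def args {n m N : ℕ} (j : ℕ) (ρ : Fin n → Fin N) (w : Fin m → Fin N) : List (Fin N) :=
  (List.ofFn ρ).take j ++ List.ofFn w

theorem map_args {n m N : ℕ} (j : ℕ) (ρ : Fin n → Fin N) (w : Fin m → Fin N) (s : Fin N → M) :
    (args j ρ w).map s = (List.ofFn (s ∘ ρ)).take j ++ List.ofFn (s ∘ w) := by
  rw [args, List.map_append, List.map_take, List.map_ofFn, List.map_ofFn]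

end SymbolEnv

theorem exists_tuple_eq {α : Type*} {m : ℕ} (u : Fin m → α) {p : (Fin m → α) → Prop} :
    (∃ a, (∀ i, u i = a i) ∧ p a) ↔ p u := by
  constructor
  · rintro ⟨a, ha, h⟩
    rwa [funext ha]
  · exact fun h => ⟨u, fun _ => rfl, h⟩

/-- The formula `t = y`, where the variables of `t` are renamed by `ρ`. -/
def graphFormula (e : SymbolEnv L L') {n : ℕ} :
    L'.Term (Fin n) → {N : ℕ} → (Fin n → Fin N) → Fin N → FunFormula k L N
  | .var x, _, ρ, y => .lit (.eq (.var (ρ x)) (.var y))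
  | .func (l := m) f ts, N, ρ, y =>
    .exs m (.and
      (.ands (List.ofFn fun i => graphFormula e (ts i) (Fin.castAdd m ∘ ρ) (Fin.natAdd N i)))
      ((e.func f).elim
        (fun g => .lit (.eq (.func g fun i => .var (Fin.natAdd N i)) (.var (Fin.castAdd m y))))
        fun p => .eqn p.1 (SymbolEnv.args p.2 (Fin.castAdd m ∘ ρ) (Fin.natAdd N))
          (Fin.castAdd m y)))

/-- Each subterm gets its own existentially bound variable, so that function variables are applied
to variables only. The witnesses are unique, which lets `exists_tuple_eq` remove them. -/
theorem sat_graphFormula (Q : GenQuantifier.{w} k) [S : L.Structure M] {e : SymbolEnv L L'}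
    {S' : L'.Structure M} {F : FunVal M} {n N : ℕ} (t : L'.Term (Fin n)) (ρ : Fin n → Fin N)
    (y : Fin N) (s : Fin N → M) (h : e.Compat S' F (s ∘ ρ)) :
    (graphFormula (k := k) e t ρ y).Sat Q F s ↔ t.realize (s ∘ ρ) = s y := by
  induction t generalizing N with
  | var x => rfl
  | @func m f ts ih =>
    have hs (a : Fin m → M) : Fin.append s a ∘ (Fin.castAdd m ∘ ρ) = s ∘ ρ := by
      rw [← Function.comp_assoc, Fin.append_comp_castAdd]
    have key (a : Fin m → M) (i : Fin m) := ih i (Fin.castAdd m ∘ ρ) (Fin.natAdd N i)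
      (Fin.append s a) (by rwa [hs])
    simp only [graphFormula, FunFormula.sat_exs, FunFormula.Sat, FunFormula.sat_ands,
      List.forall_mem_ofFn_iff, key, hs, Fin.append_right, Term.realize]
    rw [exists_tuple_eq, h.func]
    cases e.func f with
    | inl g =>
      simp only [Sum.elim_inl, FunFormula.Sat, Literal.Realize, Term.realize, Fin.append_left,
        Fin.append_right]
    | inr p =>
      simp only [Sum.elim_inr, FunFormula.Sat, SymbolEnv.map_args, hs, Fin.append_left,
        Fin.append_comp_natAdd]

/-- The formula that binds a tuple of variables to the values of the terms `ts`. -/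
def bindTerms (e : SymbolEnv L L') {n m : ℕ} (ts : Fin m → L'.Term (Fin n))
    (φ : FunFormula k L (n + m)) : FunFormula k L n :=
  .exs m (.and (.ands (List.ofFn fun i =>
    graphFormula e (ts i) (Fin.castAdd m) (Fin.natAdd n i))) φ)

theorem sat_bindTerms (Q : GenQuantifier.{w} k) [S : L.Structure M] {e : SymbolEnv L L'}
    {S' : L'.Structure M} {F : FunVal M} {n m : ℕ} (ts : Fin m → L'.Term (Fin n))
    (φ : FunFormula k L (n + m)) (s : Fin n → M) (h : e.Compat S' F s) :
    (bindTerms e ts φ).Sat Q F s ↔ φ.Sat Q F (Fin.append s fun i => (ts i).realize s) := by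
  have key (a : Fin m → M) (i : Fin m) := sat_graphFormula Q (ts i) (Fin.castAdd m)
    (Fin.natAdd n i) (Fin.append s a) (by rwa [Fin.append_comp_castAdd])
  simp only [bindTerms, FunFormula.sat_exs, FunFormula.Sat, FunFormula.sat_ands,
    List.forall_mem_ofFn_iff, key, Fin.append_comp_castAdd, Fin.append_right]
  rw [exists_tuple_eq]

/-- The translation of a literal in the vocabulary `L'` into a formula with function variables. -/
def Literal.toFun (e : SymbolEnv L L') {n : ℕ} : Literal L' n → FunFormula k L n
  | .eq t₁ t₂ => bindTerms e ![t₁, t₂] (.lit (.eq (.var (Fin.natAdd n 0)) (.var (Fin.natAdd n 1))))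
  | .ne t₁ t₂ => bindTerms e ![t₁, t₂] (.lit (.ne (.var (Fin.natAdd n 0)) (.var (Fin.natAdd n 1))))
  | .rel (m := m) R ts => bindTerms e ts ((e.rel R).elim
      (fun P => .lit (.rel P fun i => .var (Fin.natAdd n i)))
      fun p => .exs 2 (.and (.eqn p.1 (SymbolEnv.args p.2 (Fin.castAdd 2 ∘ Fin.castAdd m)
          (Fin.castAdd 2 ∘ Fin.natAdd n)) (Fin.natAdd (n + m) 0))
        (.and (.eqn (p.1 + 1) (SymbolEnv.args p.2 (Fin.castAdd 2 ∘ Fin.castAdd m)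
          (Fin.castAdd 2 ∘ Fin.natAdd n)) (Fin.natAdd (n + m) 1))
          (.lit (.eq (.var (Fin.natAdd (n + m) 0)) (.var (Fin.natAdd (n + m) 1)))))))
  | .nrel (m := m) R ts => bindTerms e ts ((e.rel R).elim
      (fun P => .lit (.nrel P fun i => .var (Fin.natAdd n i)))
      fun p => .exs 2 (.and (.eqn p.1 (SymbolEnv.args p.2 (Fin.castAdd 2 ∘ Fin.castAdd m)
          (Fin.castAdd 2 ∘ Fin.natAdd n)) (Fin.natAdd (n + m) 0))
        (.and (.eqn (p.1 + 1) (SymbolEnv.args p.2 (Fin.castAdd 2 ∘ Fin.castAdd m)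
          (Fin.castAdd 2 ∘ Fin.natAdd n)) (Fin.natAdd (n + m) 1))
          (.lit (.ne (.var (Fin.natAdd (n + m) 0)) (.var (Fin.natAdd (n + m) 1)))))))

theorem exists_pair_eq {α : Type*} (x y : α) {p : α → α → Prop} :
    (∃ a : Fin 2 → α, x = a 0 ∧ y = a 1 ∧ p (a 0) (a 1)) ↔ p x y := by
  constructor
  · rintro ⟨a, rfl, rfl, h⟩
    exact h
  · exact fun h => ⟨![x, y], rfl, rfl, h⟩

/-- Even a negated relation literal uses the equations positively: the two function values exist and
are unique, so it suffices to name them and state that they differ. -/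
theorem Literal.sat_toFun (Q : GenQuantifier.{w} k) [S : L.Structure M] {e : SymbolEnv L L'}
    {S' : L'.Structure M} {F : FunVal M} {n : ℕ} (l : Literal L' n) (s : Fin n → M)
    (h : e.Compat S' F s) : (l.toFun (k := k) e).Sat Q F s ↔ l.Realize s := by
  cases l with
  | eq t₁ t₂ =>
    simp only [toFun, sat_bindTerms Q _ _ s h, FunFormula.Sat, Realize, Term.realize,
      Fin.append_right, Matrix.cons_val_zero, Matrix.cons_val_one]
  | ne t₁ t₂ =>
    simp only [toFun, sat_bindTerms Q _ _ s h, FunFormula.Sat, Realize, Term.realize,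
      Fin.append_right, Matrix.cons_val_zero, Matrix.cons_val_one]
  | rel R ts =>
    simp only [toFun, sat_bindTerms Q _ _ s h, Realize]
    rw [h.rel]
    cases e.rel R with
    | inl P =>
      simp only [Sum.elim_inl, FunFormula.Sat, Realize, Term.realize, Fin.append_right]
    | inr p =>
      simp only [Sum.elim_inr, FunFormula.sat_exs, FunFormula.Sat, Realize, Term.realize,
        SymbolEnv.map_args, ← Function.comp_assoc, Fin.append_comp_castAdd,
        Fin.append_comp_natAdd, Fin.append_right]
      exact exists_pair_eq _ _
  | nrel R ts =>
    simp only [toFun, sat_bindTerms Q _ _ s h, Realize]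
    rw [h.rel]
    cases e.rel R with
    | inl P =>
      simp only [Sum.elim_inl, FunFormula.Sat, Realize, Term.realize, Fin.append_right]
    | inr p =>
      simp only [Sum.elim_inr, FunFormula.sat_exs, FunFormula.Sat, Realize, Term.realize,
        SymbolEnv.map_args, ← Function.comp_assoc, Fin.append_comp_castAdd,
        Fin.append_comp_natAdd, Fin.append_right]
      exact exists_pair_eq (p := fun x y => x ≠ y) _ _

/-! ### Skolemization of second-order quantifiers -/

namespace ESOFormula

/-- The number of function variables that the translation of a formula binds. -/
def numVars : {L' : FirstOrder.Language.{u, v}} → {n : ℕ} → ESOFormula k L' n → ℕ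
  | _, _, .lit _ => 0
  | _, _, .and φ ψ => φ.numVars + ψ.numVars
  | _, _, .or φ ψ => φ.numVars + ψ.numVars
  | _, _, .ex φ => φ.numVars
  | _, _, .all φ => φ.numVars
  | _, _, .quant φ => φ.numVars
  | _, _, .exFun _ φ => 1 + φ.numVars
  | _, _, .exRel _ φ => 2 + φ.numVars

/-- The translation of a formula of `ESO(Q)` into a formula with free function variables, the new
ones having indices from `c` on. -/
def toFun : {L' : FirstOrder.Language.{u, v}} → {n : ℕ} → ESOFormula k L' n → SymbolEnv L L' →
    (c : ℕ) → FunFormula k L n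
  | _, _, .lit l, e, _ => l.toFun e
  | _, _, .and φ ψ, e, c => .and (φ.toFun e c) (ψ.toFun e (c + φ.numVars))
  | _, _, .or φ ψ, e, c => .or (φ.toFun e c) (ψ.toFun e (c + φ.numVars))
  | _, _, .ex φ, e, c => .ex (φ.toFun e c)
  | _, _, .all φ, e, c => .all (φ.toFun e c)
  | _, _, .quant φ, e, c => .quant (φ.toFun e c)
  | _, n, .exFun m φ, e, c => φ.toFun (e.addFun n c m) (c + 1)
  | _, n, .exRel m φ, e, c => φ.toFun (e.addRel n c m) (c + 2)

theorem ofFn_snoc_append {n : ℕ} (s : Fin n → M) (a : M) (l : List M) :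
    List.ofFn (Fin.snoc s a : Fin (n + 1) → M) ++ l = List.ofFn s ++ (a :: l) := by
  rw [← Fin.append_right_eq_snoc s fun _ => a, List.ofFn_fin_append]
  simp

theorem ofFn_append_append {n m : ℕ} (s : Fin n → M) (a : Fin m → M) (l : List M) :
    List.ofFn (Fin.append s a) ++ l = List.ofFn s ++ (List.ofFn a ++ l) := by
  rw [List.ofFn_fin_append, List.append_assoc]

/-- The translation of a formula depends on the values of the new function variables only at
tuples that extend the assignment. -/
theorem sat_toFun_congr (Q : GenQuantifier.{w} k) (hQ : Q.MonotoneIncreasing) [Nonempty M]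
    [L.Structure M] {n : ℕ} (φ : ESOFormula k L' n) {e : SymbolEnv L L'} {c : ℕ}
    (hb : e.Bounded n c) {S' : L'.Structure M} {F F' : FunVal M} {s : Fin n → M}
    (h : e.Compat S' F s) (h' : e.Compat S' F' s)
    (hF : ∀ i, c ≤ i → i < c + φ.numVars → ∀ l, F i (List.ofFn s ++ l) = F' i (List.ofFn s ++ l))
    (hs : (φ.toFun e c).Sat Q F s) : (φ.toFun e c).Sat Q F' s := by
  induction φ generalizing c with
  | lit l =>
    rw [toFun, Literal.sat_toFun Q _ _ h] at hs
    rwa [toFun, Literal.sat_toFun Q _ _ h']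
  | and φ ψ ih₁ ih₂ =>
    rw [numVars] at hF
    exact ⟨ih₁ hb h h' (fun i hi hi' => hF i hi (by omega)) hs.1,
      ih₂ (hb.mono le_rfl (by omega)) h h' (fun i hi hi' => hF i (by omega) (by omega)) hs.2⟩
  | or φ ψ ih₁ ih₂ =>
    rw [numVars] at hF
    exact hs.imp (ih₁ hb h h' (fun i hi hi' => hF i hi (by omega)))
      (ih₂ (hb.mono le_rfl (by omega)) h h' (fun i hi hi' => hF i (by omega) (by omega)))
  | ex φ ih =>
    obtain ⟨a, ha⟩ := hs
    refine ⟨a, ih (hb.mono (by omega) le_rfl) (h.snoc hb a) (h'.snoc hb a) ?_ ha⟩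
    intro i hi hi' l
    rw [ofFn_snoc_append]
    exact hF i hi hi' _
  | all φ ih =>
    intro a
    refine ih (hb.mono (by omega) le_rfl) (h.snoc hb a) (h'.snoc hb a) ?_ (hs a)
    intro i hi hi' l
    rw [ofFn_snoc_append]
    exact hF i hi hi' _
  | quant φ ih =>
    refine hQ M _ _ (fun a ha => ?_) hs
    refine ih (hb.mono (by omega) le_rfl) (h.append hb a) (h'.append hb a) ?_ ha
    intro i hi hi' l
    rw [ofFn_append_append]
    exact hF i hi hi' _
  | exFun m φ ih =>
    rw [numVars] at hF
    -- One interpretation of the new symbol suits both valuations, since they agree at all tuples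
    -- extending s.
    refine ih (S' := expandFun S' fun a => F c (List.ofFn s ++ List.ofFn a)) (hb.addFun m)
      (h.addFun c fun a => rfl) (h'.addFun c fun a => hF c le_rfl (by omega) _)
      (fun i hi hi' => hF i (by omega) (by omega)) hs
  | exRel m φ ih =>
    rw [numVars] at hF
    refine ih (S' := expandRel S' fun a => F c (List.ofFn s ++ List.ofFn a) =
      F (c + 1) (List.ofFn s ++ List.ofFn a)) (hb.addRel m)
      (h.addRel c fun a => Iff.rfl) (h'.addRel c fun a => ?_)
      (fun i hi hi' => hF i (by omega) (by omega)) hs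
    rw [hF c le_rfl (by omega), hF (c + 1) (by omega) (by omega)]

/-- The entries `n, …, n + m - 1` of a list. -/
noncomputable def entries [Nonempty M] (n m : ℕ) (l : List M) : Fin m → M :=
  fun i => l.getD (n + i) (Classical.arbitrary M)

theorem entries_ofFn [Nonempty M] {n m : ℕ} (s : Fin n → M) (a : Fin m → M) (l : List M) :
    entries n m (List.ofFn s ++ (List.ofFn a ++ l)) = a := by
  funext i
  simp [entries, List.getElem?_append]

/-- Valuations that agree on the variables below `c` can be amalgamated along the tuples that extend
an assignment. -/
theorem exists_amalgam [Nonempty M] (F : FunVal M) (c : ℕ) {n m : ℕ} (s : Fin n → M)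
    (G : (Fin m → M) → FunVal M) :
    ∃ F' : FunVal M, (∀ i < c, F' i = F i) ∧ ∀ a i, c ≤ i → ∀ l,
      F' i (List.ofFn (Fin.append s a) ++ l) = G a i (List.ofFn (Fin.append s a) ++ l) := by
  -- The tuple a can be read off from the argument list, so the valuations `G a` do not interfere.
  refine ⟨fun i l => if i < c then F i l else G (entries n m l) i l, fun i hi => ?_,
    fun a i hi l => ?_⟩
  · funext l
    exact if_pos hi
  · simp only [not_lt.2 hi, if_false, ofFn_append_append, entries_ofFn]

/-- Witnesses combine because the two sides of a connective own disjoint blocks of indices, and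
different values of a quantified variable own disjoint sets of argument tuples. Two elements of M
are needed to code relations by pairs of functions. -/
theorem sat_toFun (Q : GenQuantifier.{w} k) (hQ : Q.MonotoneIncreasing) [Nontrivial M]
    [L.Structure M] {n : ℕ} (φ : ESOFormula k L' n) {e : SymbolEnv L L'} {c : ℕ}
    (hb : e.Bounded n c) {S' : L'.Structure M} {F : FunVal M} {s : Fin n → M}
    (h : e.Compat S' F s) :
    φ.Sat Q S' s ↔ ∃ F' : FunVal M, (∀ i < c, F' i = F i) ∧ (φ.toFun e c).Sat Q F' s := by
  induction φ generalizing c F with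
  | lit l =>
    rw [toFun, Sat]
    constructor
    · exact fun hl => ⟨F, fun _ _ => rfl, (Literal.sat_toFun Q l s h).2 hl⟩
    · rintro ⟨F', hF, hl⟩
      exact (Literal.sat_toFun Q l s (h.congr hb hF fun _ _ => rfl)).1 hl
  | and φ ψ ih₁ ih₂ =>
    have hb' := hb.mono le_rfl (Nat.le_add_right c φ.numVars)
    constructor
    · rintro ⟨h₁, h₂⟩
      obtain ⟨F₁, hF₁, hs₁⟩ := (ih₁ hb h).1 h₁
      have hc₁ := h.congr hb hF₁ fun _ _ => rfl
      obtain ⟨F₂, hF₂, hs₂⟩ := (ih₂ hb' hc₁).1 h₂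
      have hc₂ := hc₁.congr hb' hF₂ fun _ _ => rfl
      refine ⟨F₂, fun i hi => (hF₂ i (by omega)).trans (hF₁ i hi), ?_, hs₂⟩
      -- Choosing witnesses for ψ may disturb all indices above the block of φ, but the truth of φ
      -- depends only on its own block.
      exact sat_toFun_congr Q hQ φ hb hc₁ hc₂ (fun i _ hi l => by rw [hF₂ i hi]) hs₁
    · rintro ⟨F', hF', hs₁, hs₂⟩
      have hc := h.congr hb hF' fun _ _ => rfl
      exact ⟨(ih₁ hb hc).2 ⟨F', fun _ _ => rfl, hs₁⟩, (ih₂ hb' hc).2 ⟨F', fun _ _ => rfl, hs₂⟩⟩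
  | or φ ψ ih₁ ih₂ =>
    have hb' := hb.mono le_rfl (Nat.le_add_right c φ.numVars)
    constructor
    · rintro (h₁ | h₂)
      · obtain ⟨F₁, hF₁, hs₁⟩ := (ih₁ hb h).1 h₁
        exact ⟨F₁, hF₁, Or.inl hs₁⟩
      · obtain ⟨F₂, hF₂, hs₂⟩ := (ih₂ hb' h).1 h₂
        exact ⟨F₂, fun i hi => hF₂ i (by omega), Or.inr hs₂⟩
    · rintro ⟨F', hF', hs⟩
      have hc := h.congr hb hF' fun _ _ => rfl
      exact hs.imp (fun hs => (ih₁ hb hc).2 ⟨F', fun _ _ => rfl, hs⟩)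
        (fun hs => (ih₂ hb' hc).2 ⟨F', fun _ _ => rfl, hs⟩)
  | @ex L' n φ ih =>
    have hb' := hb.mono n.le_succ le_rfl
    constructor
    · rintro ⟨a, ha⟩
      obtain ⟨F', hF', hs⟩ := (ih hb' (h.snoc hb a)).1 ha
      exact ⟨F', hF', a, hs⟩
    · rintro ⟨F', hF', a, hs⟩
      exact ⟨a, (ih hb' (h.snoc hb a)).2 ⟨F', hF', hs⟩⟩
  | @all L' n φ ih =>
    have hb' := hb.mono n.le_succ le_rfl
    constructor
    · intro ha
      choose G hG hs using fun a => (ih hb' (h.snoc hb a)).1 (ha a)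
      obtain ⟨F', hF', hFG⟩ := exists_amalgam F c s fun a : Fin 1 → M => G (a 0)
      refine ⟨F', hF', fun a => ?_⟩
      have hc := h.snoc hb a
      refine sat_toFun_congr Q hQ φ hb' (hc.congr hb' (hG a) fun _ _ => rfl)
        (hc.congr hb' hF' fun _ _ => rfl) (fun i hi _ l => ?_) (hs a)
      have := hFG (fun _ => a) i hi l
      rw [Fin.append_right_eq_snoc] at this
      exact this.symm
    · rintro ⟨F', hF', hs⟩ a
      exact (ih hb' (h.snoc hb a)).2 ⟨F', hF', hs a⟩
  | @quant L' n φ ih =>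
    have hb' := hb.mono (Nat.le_add_right n k) le_rfl
    constructor
    · intro ha
      have hex (a : Fin k → M) : ∃ F' : FunVal M, (∀ i < c, F' i = F i) ∧
          (φ.Sat Q S' (Fin.append s a) → (φ.toFun e c).Sat Q F' (Fin.append s a)) := by
        by_cases hφ : φ.Sat Q S' (Fin.append s a)
        · obtain ⟨F', hF', hs⟩ := (ih hb' (h.append hb a)).1 hφ
          exact ⟨F', hF', fun _ => hs⟩
        -- Tuples outside the defined set need no witness: by monotonicity of Q it is enough that
        -- the translated set contains the original one.
        · exact ⟨F, fun _ _ => rfl, fun h => absurd h hφ⟩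
      choose G hG hs using hex
      obtain ⟨F', hF', hFG⟩ := exists_amalgam F c s G
      refine ⟨F', hF', hQ M _ _ (fun a hφ => ?_) ha⟩
      have hc := h.append hb a
      exact sat_toFun_congr Q hQ φ hb' (hc.congr hb' (hG a) fun _ _ => rfl)
        (hc.congr hb' hF' fun _ _ => rfl) (fun i hi _ l => (hFG a i hi l).symm) (hs a hφ)
    · rintro ⟨F', hF', hs⟩
      exact hQ M _ _ (fun a ha => (ih hb' (h.append hb a)).2 ⟨F', hF', ha⟩) hs
  | @exFun L' n m φ ih =>
    constructor
    · rintro ⟨f, hf⟩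
      let F₁ : FunVal M := fun i l => if i < c then F i l else f (entries n m l)
      have hF₁ : ∀ i < c, F₁ i = F i := fun i hi => funext fun l => if_pos hi
      have hc := (h.congr hb hF₁ fun _ _ => rfl).addFun c (f := f) fun a => by
        have := entries_ofFn s a []
        rw [List.append_nil] at this
        simp only [F₁, lt_irrefl, if_false, this]
      obtain ⟨F', hF', hs⟩ := (ih (hb.addFun m) hc).1 hf
      exact ⟨F', fun i hi => (hF' i (by omega)).trans (hF₁ i hi), hs⟩
    · rintro ⟨F', hF', hs⟩
      have hc := (h.congr hb hF' fun _ _ => rfl).addFun (m := m) c fun a => rfl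
      exact ⟨_, (ih (hb.addFun m) hc).2 ⟨F', fun _ _ => rfl, hs⟩⟩
  | @exRel L' n m φ ih =>
    constructor
    · rintro ⟨R, hR⟩
      classical
      obtain ⟨x, y, hxy⟩ := exists_pair_ne M
      -- The variable `c` is constantly x, while `c + 1` takes the value x exactly where R holds;
      -- they agree exactly on R.
      let F₁ : FunVal M := fun i l => if i < c then F i l else
        if i = c ∨ R (entries n m l) then x else y
      have hF₁ : ∀ i < c, F₁ i = F i := fun i hi => funext fun l => if_pos hi
      have hc := (h.congr hb hF₁ fun _ _ => rfl).addRel c (R := R) fun a => by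
        have := entries_ofFn s a []
        rw [List.append_nil] at this
        by_cases hRa : R a <;> simp [F₁, this, hRa, hxy]
      obtain ⟨F', hF', hs⟩ := (ih (hb.addRel m) hc).1 hR
      exact ⟨F', fun i hi => (hF' i (by omega)).trans (hF₁ i hi), hs⟩
    · rintro ⟨F', hF', hs⟩
      have hc := (h.congr hb hF' fun _ _ => rfl).addRel (m := m) c fun a => Iff.rfl
      exact ⟨_, (ih (hb.addRel m) hc).2 ⟨F', fun _ _ => rfl, hs⟩⟩

end ESOFormula

end ESOToFun

/-! ### From ESO(Q) to D(Q) -/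

section ESOToD

variable {k : ℕ} {L L' : FirstOrder.Language.{u, v}} {M : Type w}

theorem DFormula.sat_empty (Q : GenQuantifier.{w} k) [L.Structure M] {n : ℕ}
    (φ : DFormula k L n) : φ.Sat Q (∅ : Team M n) := by
  induction φ with
  | lit l => exact fun s hs => hs.elim
  | dep ts t => exact fun s hs => hs.elim
  | ndep ts t => rfl
  | and φ ψ ih₁ ih₂ => exact ⟨ih₁, ih₂⟩
  | or φ ψ ih₁ ih₂ => exact ⟨∅, ∅, (Set.empty_union _).symm, ih₁, ih₂⟩
  | ex φ ih =>
    refine ⟨fun s => s.2.elim, ?_⟩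
    convert ih
    exact Set.eq_empty_of_forall_notMem fun _ ⟨s, _⟩ => s.2
  | all φ ih =>
    rw [Sat]
    convert ih
    exact Set.eq_empty_of_forall_notMem fun _ ⟨s, hs, _⟩ => hs
  | quant φ ih =>
    refine ⟨fun s => s.2.elim, fun s => s.2.elim, ?_⟩
    convert ih
    exact Set.eq_empty_of_forall_notMem fun _ ⟨s, _⟩ => s.2

namespace DSentence

theorem holds_and (Q : GenQuantifier.{w} k) [L.Structure M] (φ ψ : DSentence k L) :
    DSentence.Holds Q (.and φ ψ) M ↔ φ.Holds Q M ∧ ψ.Holds Q M := Iff.rfl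

/-- The only subteams of {ε} are ∅ and {ε}, and ∅ satisfies every formula, so disjunction of
sentences is classical. -/
theorem holds_or (Q : GenQuantifier.{w} k) [L.Structure M] (φ ψ : DSentence k L) :
    DSentence.Holds Q (.or φ ψ) M ↔ φ.Holds Q M ∨ ψ.Holds Q M := by
  constructor
  · rintro ⟨Y, Z, h, hY, hZ⟩
    rcases Set.subset_singleton_iff_eq.1 (h ▸ Set.subset_union_left : Y ⊆ _) with rfl | rfl
    · right
      rw [Set.empty_union] at h
      rwa [Holds, h]
    · exact Or.inl hY
  · rintro (h | h)
    · exact ⟨_, ∅, (Set.union_empty _).symm, h, DFormula.sat_empty Q ψ⟩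
    · exact ⟨∅, _, (Set.empty_union _).symm, DFormula.sat_empty Q φ, h⟩

/-- The sentence that says that the universe has at least two elements. -/
def nontrivial : DSentence k L :=
  .ex (.ex (.lit (.ne (.var 0) (.var 1))))

theorem holds_nontrivial (Q : GenQuantifier.{w} k) [L.Structure M] :
    (nontrivial : DSentence k L).Holds Q M ↔ Nontrivial M := by
  constructor
  · rintro ⟨f, g, h⟩
    exact ⟨_, _, h _ ⟨⟨_, ⟨⟨_, rfl⟩, rfl⟩⟩, rfl⟩⟩
  · rintro ⟨x, y, hxy⟩
    refine ⟨fun _ => x, fun _ => y, ?_⟩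
    rintro _ ⟨⟨_, ⟨s, rfl⟩⟩, rfl⟩
    exact hxy

/-- The sentence that says that the universe has at most one element. -/
def subsingleton : DSentence k L :=
  .all (.all (.lit (.eq (.var 0) (.var 1))))

theorem holds_subsingleton (Q : GenQuantifier.{w} k) [L.Structure M] :
    (subsingleton : DSentence k L).Holds Q M ↔ Subsingleton M := by
  constructor
  · intro h
    exact ⟨fun x y => h _ ⟨_, ⟨_, rfl, x, rfl⟩, y, rfl⟩⟩
  · intro h s hs
    exact Subsingleton.elim _ _

/-- The sentence `Q x̄ ⊤`. -/
def quantVerum : DSentence k L := .quant (.verum _)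

theorem holds_quantVerum (Q : GenQuantifier.{w} k) (hQ : Q.MonotoneIncreasing) [Nonempty M]
    [L.Structure M] : (quantVerum : DSentence k L).Holds Q M ↔ Set.univ ∈ Q M := by
  constructor
  · rintro ⟨F, hF, -⟩
    exact hQ M _ _ (Set.subset_univ _) (hF ⟨_, rfl⟩)
  · exact fun h => ⟨fun _ => Set.univ, fun _ => h, DFormula.sat_verum Q _⟩

/-- A contradictory sentence. -/
def falsum : DSentence k L := .ex (.lit (.ne (.var 0) (.var 0)))

theorem not_holds_falsum (Q : GenQuantifier.{w} k) [L.Structure M] :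
    ¬ (falsum : DSentence k L).Holds Q M :=
  fun ⟨_, h⟩ => h _ ⟨⟨_, rfl⟩, rfl⟩ rfl

theorem holds_verum (Q : GenQuantifier.{w} k) [L.Structure M] :
    DSentence.Holds Q (DFormula.verum 0 : DSentence k L) M :=
  DFormula.sat_verum Q _

end DSentence

/-! ### One-element universes -/

/-- The truth value of a literal in one-element structures, where the relation symbols of `L'` are
interpreted by symbols of `L` or by truth values. -/
def Literal.toDSingleton (e : ∀ {m}, L'.Relations m → L.Relations m ⊕ Bool) {n : ℕ} :
    Literal L' n → DSentence k L
  | .eq _ _ => .verum 0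
  | .ne _ _ => DSentence.falsum
  | .rel R _ => (e R).elim (fun P => .ex (.lit (.rel P fun _ => .var 0)))
      fun b => if b then .verum 0 else DSentence.falsum
  | .nrel R _ => (e R).elim (fun P => .ex (.lit (.nrel P fun _ => .var 0)))
      fun b => if b then DSentence.falsum else .verum 0

/-- The translation of a formula of `ESO(Q)` that is correct in one-element structures. -/
def ESOFormula.toDSingleton : {L' : FirstOrder.Language.{u, v}} → {n : ℕ} → ESOFormula k L' n →
    (∀ {m}, L'.Relations m → L.Relations m ⊕ Bool) → DSentence k L
  | _, _, .lit l, e => l.toDSingleton e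
  | _, _, .and φ ψ, e => .and (φ.toDSingleton e) (ψ.toDSingleton e)
  | _, _, .or φ ψ, e => .or (φ.toDSingleton e) (ψ.toDSingleton e)
  | _, _, .ex φ, e => φ.toDSingleton e
  | _, _, .all φ, e => φ.toDSingleton e
  | _, _, .quant φ, e => .and (φ.toDSingleton e) DSentence.quantVerum
  | _, _, .exFun _ φ, e => φ.toDSingleton fun R => e (m := _) R
  | L', _, .exRel m φ, e =>
    .or (φ.toDSingleton (L' := addRel L' m) fun R => match R with
        | .old R => e R
        | .new => .inr true)
      (φ.toDSingleton (L' := addRel L' m) fun R => match R with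
        | .old R => e R
        | .new => .inr false)

theorem holds_ex_lit (Q : GenQuantifier.{w} k) [Nonempty M] [Subsingleton M] [L.Structure M]
    (l : Literal L 1) (s : Fin 1 → M) : DSentence.Holds Q (.ex (.lit l)) M ↔ l.Realize s := by
  constructor
  · rintro ⟨f, h⟩
    convert h _ ⟨⟨_, rfl⟩, rfl⟩
  · intro h
    refine ⟨fun _ => Classical.arbitrary M, fun t _ => ?_⟩
    rwa [Subsingleton.elim t s]

/-- There is only one assignment and one tuple of each length, so first-order and function
quantifiers are vacuous and a relation is a truth value. The set defined under Q is ∅ or M^k; since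
∅ ∉ Q_M, the quantified formula says that φ holds and M^k ∈ Q_M. -/
theorem ESOFormula.holds_toDSingleton (Q : GenQuantifier.{w} k) (hQ : Q.MonotoneIncreasing)
    [Nonempty M] (hempty : ∅ ∉ Q M) [Subsingleton M] [S : L.Structure M] {n : ℕ}
    (φ : ESOFormula k L' n) (e : ∀ {m}, L'.Relations m → L.Relations m ⊕ Bool)
    (S' : L'.Structure M) (he : ∀ {m} (R : L'.Relations m) a,
      S'.RelMap R a ↔ (e R).elim (fun P => S.RelMap P a) fun b => b = true) (s : Fin n → M) :
    (φ.toDSingleton e).Holds Q M ↔ φ.Sat Q S' s := by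
  induction φ with
  | lit l =>
    cases l with
    | eq t₁ t₂ => exact iff_of_true (DSentence.holds_verum Q) (Subsingleton.elim _ _)
    | ne t₁ t₂ =>
      exact iff_of_false (DSentence.not_holds_falsum Q) fun h => h (Subsingleton.elim _ _)
    | rel R ts =>
      rw [toDSingleton, Literal.toDSingleton, Sat, Literal.Realize, he]
      cases e R with
      | inl P =>
        simp only [Sum.elim_inl]
        rw [holds_ex_lit Q _ fun _ => Classical.arbitrary M, Literal.Realize]
        refine iff_of_eq (congrArg _ (Subsingleton.elim _ _))
      | inr b =>
        cases b
        · simpa using DSentence.not_holds_falsum Q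
        · simpa using DSentence.holds_verum Q
    | nrel R ts =>
      rw [toDSingleton, Literal.toDSingleton, Sat, Literal.Realize, he]
      cases e R with
      | inl P =>
        simp only [Sum.elim_inl]
        rw [holds_ex_lit Q _ fun _ => Classical.arbitrary M, Literal.Realize]
        refine not_congr (iff_of_eq (congrArg _ (Subsingleton.elim _ _)))
      | inr b =>
        cases b
        · simpa using DSentence.holds_verum Q
        · simpa using DSentence.not_holds_falsum Q
  | and φ ψ ih₁ ih₂ => rw [toDSingleton, DSentence.holds_and, ih₁ e S' he, ih₂ e S' he, Sat]
  | or φ ψ ih₁ ih₂ => rw [toDSingleton, DSentence.holds_or, ih₁ e S' he, ih₂ e S' he, Sat]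
  | ex φ ih =>
    simp only [toDSingleton, Sat, ← ih e S' he, exists_const]
  | all φ ih =>
    simp only [toDSingleton, Sat, ← ih e S' he, forall_const]
  | quant φ ih =>
    simp only [toDSingleton, Sat, ← ih e S' he, DSentence.holds_and,
      DSentence.holds_quantVerum Q hQ]
    by_cases h : DSentence.Holds Q (φ.toDSingleton e) M
    · simp only [h, true_and]
      rfl
    · simp only [h, false_and, false_iff]
      exact hempty
  | exFun m φ ih =>
    have key (f : (Fin m → M) → M) := ih (fun R => e (m := _) R) (expandFun S' f)
      (fun R a => he (m := _) R a) s
    simp only [toDSingleton, Sat, ← key, exists_const]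
  | @exRel L' n m φ ih =>
    have key (b : Bool) := ih (fun R => match R with
        | .old R => e R
        | .new => .inr b) (expandRel S' fun _ => b = true) (fun R a => by
          cases R with
          | old R => exact he R a
          | new => exact Iff.rfl) s
    rw [toDSingleton, DSentence.holds_or, key true, key false, Sat]
    constructor
    · rintro (h | h)
      exacts [⟨_, h⟩, ⟨_, h⟩]
    · rintro ⟨R, hR⟩
      by_cases h : R fun _ => Classical.arbitrary M
      · left
        convert hR
        simpa [Subsingleton.elim _ (fun _ : Fin m => Classical.arbitrary M)] using h
      · right
        convert hR
        simpa [Subsingleton.elim _ (fun _ : Fin m => Classical.arbitrary M)] using h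

/-! ### Universes with at least two elements, and the final sentence -/

theorem GenQuantifier.MonotoneIncreasing.restrict {Q : GenQuantifier.{w} k}
    (hQ : Q.MonotoneIncreasing) (b : Bool) : (Q.restrict b).MonotoneIncreasing :=
  fun M _ A B hAB hA => ⟨hA.1, hQ M A B hAB hA.2⟩

/-- Formulas of `ESO(Q)` are monotone in the quantifier. -/
theorem ESOFormula.Sat.mono_quant {Q Q' : GenQuantifier.{w} k} (hQ' : Q'.MonotoneIncreasing)
    [Nonempty M] (hQQ' : Q M ⊆ Q' M) {n : ℕ} {φ : ESOFormula k L n} {S : L.Structure M}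
    {s : Fin n → M} (h : φ.Sat Q S s) : φ.Sat Q' S s := by
  induction φ with
  | lit l => exact h
  | and φ ψ ih₁ ih₂ => exact ⟨ih₁ h.1, ih₂ h.2⟩
  | or φ ψ ih₁ ih₂ => exact h.imp ih₁ ih₂
  | ex φ ih => exact h.imp fun a => ih
  | all φ ih => exact fun a => ih (h a)
  | quant φ ih => exact hQ' M _ _ (fun a => ih) (hQQ' h)
  | exFun m φ ih => exact h.imp fun a => ih
  | exRel m φ ih => exact h.imp fun a => ih

/-- The translation of a sentence of `ESO(Q)` that is correct in structures with at least two
elements, with the subformulas that begin with `Q` replaced by a contradiction if `b` is false. -/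
def ESOFormula.toD (b : Bool) (ψ : ESOSentence k L) : DSentence k L :=
  (FunFormula.prenex b (ESOFormula.toFun ψ ⟨.inl, .inl⟩ 0) id fun _ _ θ => .qf θ).toD []

/-- On the team {ε} with no equations recorded, the valuation produced by `PrenexFormula.sat_toD` is
just a Skolem valuation for ψ; the initial context is the identity. -/
theorem ESOFormula.holds_toD (Q : GenQuantifier.{w} k) (hQ : Q.MonotoneIncreasing)
    [Nontrivial M] (hempty : ∅ ∉ Q M) {b : Bool} (htop : b = true → Set.univ ∈ Q M)
    [S : L.Structure M] (ψ : ESOSentence k L) :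
    (ESOFormula.toD b ψ).Holds Q M ↔ ψ.Holds (Q.restrict b) M := by
  rw [DSentence.Holds, toD, PrenexFormula.sat_toD Q hQ hempty, ESOSentence.Holds,
    sat_toFun (Q.restrict b) (hQ.restrict b) ψ (e := ⟨.inl, .inl⟩) (c := 0)
      (F := fun _ _ => Classical.arbitrary M)]
  · refine exists_congr fun F => ?_
    simp only [Set.mem_singleton_iff, forall_eq, List.not_mem_nil, false_imp_iff, implies_true,
      and_true, not_lt_zero, true_and]
    exact FunFormula.sat_prenex Q hempty htop F _ id _ (fun _ p => p) (fun _ _ _ h => h)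
      (fun _ _ _ _ => Iff.rfl) _
  · exact ⟨fun f p h => (nomatch h), fun R p h => (nomatch h)⟩
  · exact ⟨fun f a => rfl, fun R a => Iff.rfl⟩

/-- No disjunct has to say that M^k ∉ Q_M: replacing subformulas that begin with Q by a
contradiction only strengthens ψ, so the translation with `false` is sound everywhere. It is also
complete when M^k ∉ Q_M, because then Q_M is empty. The translation with `true` is guarded by the
sentence saying that M^k ∈ Q_M. -/
theorem exists_D_of_ESO (Q : GenQuantifier.{w} k) (hQ : Q.MonotoneIncreasing)
    (hempty : ∀ (M : Type w) [Nonempty M], (∅ : Set (Fin k → M)) ∉ Q M) (ψ : ESOSentence k L) :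
    ∃ φ : DSentence k L, ∀ (M : Type w) [Nonempty M] [L.Structure M],
      ψ.Holds Q M ↔ φ.Holds Q M := by
  refine ⟨.or (.and DSentence.subsingleton (ESOFormula.toDSingleton ψ .inl))
    (.and DSentence.nontrivial (.or (ESOFormula.toD false ψ)
      (.and DSentence.quantVerum (ESOFormula.toD true ψ)))), fun M _ S => ?_⟩
  simp only [DSentence.holds_or, DSentence.holds_and, DSentence.holds_subsingleton,
    DSentence.holds_nontrivial, DSentence.holds_quantVerum Q hQ]
  rcases subsingleton_or_nontrivial M with hM | hM
  · simp only [hM, not_nontrivial_iff_subsingleton.2 hM, true_and, false_and, or_false]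
    exact (ESOFormula.holds_toDSingleton Q hQ (hempty M) ψ .inl S (fun _ _ => Iff.rfl) _).symm
  · simp only [hM, not_subsingleton_iff_nontrivial.2 hM, true_and, false_and, false_or]
    have hmono (b : Bool) (h : ψ.Holds (Q.restrict b) M) : ψ.Holds Q M :=
      ESOFormula.Sat.mono_quant hQ (fun A hA => hA.2) h
    rw [ESOFormula.holds_toD Q hQ (hempty M) (by simp)]
    by_cases htop : Set.univ ∈ Q M
    · rw [ESOFormula.holds_toD Q hQ (hempty M) fun _ => htop]
      refine ⟨fun h => Or.inr ⟨htop, ?_⟩, fun h => h.elim (hmono _) fun h => hmono _ h.2⟩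
      exact ESOFormula.Sat.mono_quant (hQ.restrict true) (fun A hA => ⟨rfl, hA⟩) h
    · simp only [htop, false_and, or_false]
      refine ⟨fun h => ?_, hmono _⟩
      exact ESOFormula.Sat.mono_quant (hQ.restrict false)
        (fun A hA => absurd (hQ M _ _ (Set.subset_univ A) hA) htop) h

end ESOToD

end TeamLogic

theorem mainTheorem1 {k : ℕ} (Q : TeamLogic.GenQuantifier.{w} k)
    (hmono : Q.MonotoneIncreasing)
    (hempty : ∀ (M : Type w) [Nonempty M], (∅ : Set (Fin k → M)) ∉ Q M)
    (L : FirstOrder.Language.{u, v}) :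
    (∀ φ : TeamLogic.DSentence k L, ∃ ψ : TeamLogic.ESOSentence k L,
      ∀ (M : Type w) [Nonempty M] [L.Structure M],
        TeamLogic.DSentence.Holds Q φ M ↔ TeamLogic.ESOSentence.Holds Q ψ M) ∧
    (∀ ψ : TeamLogic.ESOSentence k L, ∃ φ : TeamLogic.DSentence k L,
      ∀ (M : Type w) [Nonempty M] [L.Structure M],
        TeamLogic.ESOSentence.Holds Q ψ M ↔ TeamLogic.DSentence.Holds Q φ M) :=
  ⟨TeamLogic.exists_ESO_of_D Q, TeamLogic.exists_D_of_ESO Q hmono hempty⟩
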